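/- There are a single randomized algorithm $A$ and an absolute constant $C>0$ such that the following holds for every finite field $\mathbb{F}_q$ with $q$ elements, every integer $n\ge 1$, every monic polynomial $P\in\mathbb{F}_q[X]$ of degree $n$ with $\#P$ nonzero monomials, all polynomials $F,G,H\in\mathbb{F}_q[X]$ of degree less than $n$, and every real $0<\epsilon<1$. Given $F,G,H$ by their dense coefficient vectors, $P$ by the list of its nonzero monomials, the integers $q$, $n$, $\#P$, and the error bound $\epsilon$ (through the integer $\lceil 1/\epsilon\rceil$), the algorithm $A$ always uses at most $$C\cdot\Bigl(\#P\cdot n+n\cdot\log_q n\cdot\max\bigl(1,\log_2\tfrac1\epsilon\bigr)\Bigr)$$ operations in $\mathbb{F}_q$ and answers True or False, such that 1. if $H=FG\bmod P$, then $A$ answers True with probability $1$; 2. if $H\ne FG\bmod P$, then $A$ answers True with probability at most $\epsilon$. Here an algorithm is a program for a random-access machine with an integer memory and a field memory, the same program for all fields and inputs. Every field addition, subtraction, multiplication or inversion, every copy of a field element or loading of $0$ or $1$, every zero test, and every draw of a uniformly random element of $\mathbb{F}_q$ or of $\{0,1\}$ counts as one operation in $\mathbb{F}_q$; operations on the integers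 (addresses and counters) are not counted. -/

import Mathlib

/-!
A uniform model of randomized algorithms over a finite field: programs for a random-access machine
with an integer memory (addresses, counters; not charged) and a field memory.  Field elements can
only be moved, combined by the field operations, drawn at random and compared with zero; each of
these actions is charged one operation.  A program is a finite text that does not depend on the
field, on the size of the input, or on the error bound.
-/

namespace FieldRAM

universe u

/-- Integer expressions.  `cell a i` is the content of entry `i` of the integer array number `a`;
`sub` is truncated subtraction and `div` is the integer quotient. -/
inductive IntExpr : Type
  | const (k : ℕ)
  | cell (a : ℕ) (i : IntExpr)
  | add (e f : IntExpr)
  | sub (e f : IntExpr)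
  | mul (e f : IntExpr)
  | div (e f : IntExpr)

/-- A reference to the entry with index `idx` of the field array number `arr`. -/
structure FieldRef : Type where
  arr : ℕ
  idx : IntExpr

/-- The right-hand sides of assignments to a field cell. -/
inductive FieldExpr : Type
  | zero
  | one
  | copy (x : FieldRef)
  | add (x y : FieldRef)
  | sub (x y : FieldRef)
  | mul (x y : FieldRef)
  | inv (x : FieldRef)

/-- Programs. -/
inductive Prog : Type
  /-- Do nothing. -/
  | skip
  /-- Run `A`, then `B`. -/
  | seq (A B : Prog)
  /-- Store the integer `e` in entry `i` of the integer array `a`. -/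
  | setInt (a : ℕ) (i e : IntExpr)
  /-- Store the field element `e` in the field cell `x`. -/
  | setField (x : FieldRef) (e : FieldExpr)
  /-- Store a uniformly random element of the field in the field cell `x`. -/
  | drawField (x : FieldRef)
  /-- Store a uniformly random element of `{0, 1}` in the field cell `x`. -/
  | drawBit (x : FieldRef)
  /-- Run `A` if the integer `e` is zero, and `B` otherwise. -/
  | ifInt (e : IntExpr) (A B : Prog)
  /-- Run `A` if the content of the field cell `x` is zero, and `B` otherwise. -/
  | ifField (x : FieldRef) (A B : Prog)
  /-- With `k` the initial value of `e`, run `A` successively `k` times; before each run the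
  counter, entry `0` of the integer array `c`, is set to `0, 1, …, k - 1` respectively. -/
  | loop (c : ℕ) (e : IntExpr) (A : Prog)

/-- The integer memory, the field memory, and the number of field operations made so far. -/
structure State (K : Type u) : Type u where
  int : ℕ → ℕ → ℕ
  fld : ℕ → ℕ → K
  ops : ℕ

/-- The array memory `m` with entry `i` of array `a` replaced by `v`. -/
def write {α : Type u} (m : ℕ → ℕ → α) (a i : ℕ) (v : α) : ℕ → ℕ → α :=
  Function.update m a (Function.update (m a) i v)

/-- The value of an integer expression. -/
def IntExpr.eval (m : ℕ → ℕ → ℕ) : IntExpr → ℕ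
  | .const k => k
  | .cell a i => m a (i.eval m)
  | .add e f => e.eval m + f.eval m
  | .sub e f => e.eval m - f.eval m
  | .mul e f => e.eval m * f.eval m
  | .div e f => e.eval m / f.eval m

/-- The content of a field cell. -/
def FieldRef.get {K : Type u} (x : FieldRef) (s : State K) : K :=
  s.fld x.arr (x.idx.eval s.int)

/-- The value of the right-hand side of a field assignment. -/
def FieldExpr.eval {K : Type u} [Field K] (s : State K) : FieldExpr → K
  | .zero => 0
  | .one => 1
  | .copy x => x.get s
  | .add x y => x.get s + y.get s
  | .sub x y => x.get s - y.get s
  | .mul x y => x.get s * y.get s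
  | .inv x => (x.get s)⁻¹

/-- Store an integer (not charged). -/
def State.putInt {K : Type u} (s : State K) (a i v : ℕ) : State K :=
  { s with int := write s.int a i v }

/-- Charge one operation. -/
def State.tick {K : Type u} (s : State K) : State K :=
  { s with ops := s.ops + 1 }

/-- Store a field element; this is charged one operation. -/
def State.putField {K : Type u} (s : State K) (x : FieldRef) (v : K) : State K :=
  { s with fld := write s.fld x.arr (x.idx.eval s.int) v, ops := s.ops + 1 }

/-- Carry out `step 0`, …, `step (k - 1)` in this order. -/
noncomputable def iterate {K : Type u} (step : ℕ → State K → PMF (State K)) :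
    ℕ → State K → PMF (State K)
  | 0, s => PMF.pure s
  | k + 1, s => (iterate step k s).bind (step k)

open Classical in
/-- The distribution of the final state of a program started in the state `s`. -/
noncomputable def Prog.run {K : Type u} [Field K] [Fintype K] :
    Prog → State K → PMF (State K)
  | .skip, s => PMF.pure s
  | .seq A B, s => (A.run s).bind B.run
  | .setInt a i e, s => PMF.pure (s.putInt a (i.eval s.int) (e.eval s.int))
  | .setField x e, s => PMF.pure (s.putField x (e.eval s))
  | .drawField x, s => (PMF.uniformOfFintype K).map (s.putField x)
  | .drawBit x, s =>
      (PMF.uniformOfFintype Bool).map (fun b => s.putField x (if b then 1 else 0))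
  | .ifInt e A B, s => if e.eval s.int = 0 then A.run s else B.run s
  | .ifField x A B, s => if x.get s = 0 then A.run s.tick else B.run s.tick
  | .loop c e A, s => iterate (fun i t => A.run (t.putInt c 0 i)) (e.eval s.int) s

/-- The distribution of the answer of a program; the answer is `true` if entry `0` of the integer
array `2` is `1` at the end, and `false` otherwise. -/
noncomputable def Prog.answer {K : Type u} [Field K] [Fintype K] (A : Prog) (s : State K) :
    PMF Bool :=
  (A.run s).map (fun t => decide (t.int 2 0 = 1))

/-- The exponents of the nonzero monomials of `P` in increasing order. -/
def exponents {K : Type u} [Field K] (P : Polynomial K) : List ℕ :=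
  P.support.sort (· ≤ ·)

/-- The initial state: `F`, `G`, `H` are given by their vectors of coefficients, `P` is given by the
list of its nonzero monomials, and the integers `q`, `n = deg P`, the number of monomials of `P`,
and `⌈1 / ε⌉` are given in the integer array `0`.  All other cells are zero. -/
noncomputable def input {K : Type u} [Field K] [Fintype K] (F G H P : Polynomial K) (ε : ℝ) :
    State K where
  int a i :=
    match a with
    | 0 => [Fintype.card K, P.natDegree, P.support.card, ⌈1 / ε⌉₊].getD i 0
    | 1 => (exponents P).getD i 0
    | _ => 0
  fld a i :=
    match a with
    | 0 => F.coeff i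
    | 1 => G.coeff i
    | 2 => H.coeff i
    | 3 => ((exponents P).map P.coeff).getD i 0
    | _ => 0
  ops := 0

end FieldRAM

/-!
The verification program reduces `D = (F * G mod P) - H` modulo random monic polynomials `R` of
degree `d` and answers true if all remainders vanish.

*Reduction.* The polynomials `G i = X ^ i * G mod P` satisfy `G (i + 1) = X * G i - c i * P` with
`c i` the coefficient of `X ^ (n - 1)` in `G i`, and `F * G mod P = ∑ f i * G i`
(`sum_coeff_mul_shiftRem`). The scalars `c i` do not depend on `R`: they are the quotient
coefficients of the long division of `X ^ n * G` by `P`, which takes `O(#P * n)` operations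
(`wp_divide`). Once they are known, the recurrence and the sum can be evaluated in `K[X] / (R)`,
where a multiplication with `X` or with a scalar takes `O(d)` operations, so that a trial takes
`O(n * d)` operations (`wp_pass`, `wp_test`).

*Error.* If `D ≠ 0` and `n ^ 2 ≤ q`, then `d = 1` suffices: `R` divides `D` with probability at
most `(n - 1) / q`, less than `1 / √q`, and `2 * ⌈log_q (1 / ε)⌉` trials are enough. For smaller
`q`, let `d = 2 * m` with `q ^ m ≥ 8 * n`. A polynomial `R` of degree `2 * m` has at most one
irreducible factor of degree greater than `m`; counting the polynomials with such a factor that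
does not divide `D` shows that at least a quarter of all `R` do not divide `D`
(`card_pow_le_card_not_dvd`). No irreducible polynomial has to be found. Now `3 * ⌈log_2 (1 / ε)⌉`
trials are enough. In both cases the product of `d` and the number of trials is `O(#P + log_q n *
max 1 (log_2 (1 / ε)))` (`trialParam_mul_degreeParam_le`); for `n = 1` a single trial with `d = 1`
is exact.

*Programs.* Statements that hold with certainty are proved with the predicate `Prog.wp`, loops by
invariants; arrays that a program does not write are unchanged (`wp_frame`).
Randomness enters only through `prob_drawVec_seq_le`, for the drawing of one polynomial, and
`toOuterMeasure_iterate_le`, for the repetition of trials.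

The field arrays are used as follows: `0`, `1`, `2`, `3` input, `4` dense `P`, `5` the division,
`6` the scalars `c i`, `7` the polynomial `R`, `8` minus `P` modulo `R`, `9` powers of `X`, `10`
the difference `D` modulo `R`, `11` temporary values, `12` minus `X ^ i * G mod P` modulo `R`,
`13` zeros. The integer variable `5` is `d`, the variable `6` is the number of trials.
-/

namespace FieldRAM

universe u

section

open scoped ENNReal

variable {K : Type u}

/-! ### Memory and iteration -/

theorem write_apply {α : Type u} (m : ℕ → ℕ → α) (a i : ℕ) (v : α) (b j : ℕ) :
    write m a i v b j = if b = a ∧ j = i then v else m b j := by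
  unfold write
  by_cases hb : b = a
  · subst hb
    by_cases hj : j = i
    · subst hj; simp
    · simp [hj]
  · simp [hb]

theorem write_of_ne {α : Type u} (m : ℕ → ℕ → α) {a b : ℕ} (h : b ≠ a) (i : ℕ) (v : α) :
    write m a i v b = m b := by
  simp [write, h]

/-- The invariant rule for iteration. -/
theorem iterate_support_invariant {step : ℕ → State K → PMF (State K)} {s : State K}
    (I : ℕ → State K → Prop) (k : ℕ) (h0 : I 0 s)
    (hstep : ∀ i < k, ∀ t, I i t → ∀ u ∈ (step i t).support, I (i + 1) u) :
    ∀ t ∈ (iterate step k s).support, I k t := by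
  induction k with
  | zero => simpa [iterate] using h0
  | succ k ih =>
    intro t ht
    simp only [iterate, PMF.mem_support_bind_iff] at ht
    obtain ⟨u, hu, ht⟩ := ht
    exact hstep k k.lt_succ_self u
      (ih (fun i hi => hstep i (hi.trans k.lt_succ_self)) u hu) t ht

/-! ### Probabilities under iteration -/

theorem toOuterMeasure_le_one {α : Type u} (p : PMF α) (E : Set α) : p.toOuterMeasure E ≤ 1 := by
  rw [PMF.toOuterMeasure_apply, ← p.tsum_coe]
  exact ENNReal.tsum_le_tsum fun a => Set.indicator_le_self E p a

/-- If `E` has probability at most `θ` under `f a` for `a` in `G` and probability `0` for the other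
`a`, then its probability under `p.bind f` is at most `θ` times that of `G` under `p`. -/
theorem toOuterMeasure_bind_le {α β : Type u} (p : PMF α) (f : α → PMF β) (E : Set β) (G : Set α)
    (θ : ℝ≥0∞) (hG : ∀ a ∈ p.support, a ∈ G → (f a).toOuterMeasure E ≤ θ)
    (hGc : ∀ a ∈ p.support, a ∉ G → (f a).toOuterMeasure E = 0) :
    (p.bind f).toOuterMeasure E ≤ p.toOuterMeasure G * θ := by
  rw [PMF.toOuterMeasure_bind_apply, PMF.toOuterMeasure_apply, ← ENNReal.tsum_mul_right]
  refine ENNReal.tsum_le_tsum fun a => ?_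
  by_cases ha : p a = 0
  · simp [ha]
  have ha' : a ∈ p.support := (PMF.mem_support_iff p a).2 ha
  by_cases hg : a ∈ G
  · rw [Set.indicator_of_mem hg]
    gcongr
    exact hG a ha' hg
  · simp [hGc a ha' hg]

/-- Independent trials: if, as long as the invariant `I` holds, one round ends in `E` with
probability at most `θ`, and `E` cannot be entered from outside, then `k` rounds end in `E` with
probability at most `θ ^ k`. -/
theorem toOuterMeasure_iterate_le {step : ℕ → State K → PMF (State K)} {s : State K}
    (I : State K → Prop) (E : Set (State K)) (θ : ℝ≥0∞) (k : ℕ) (h0 : I s)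
    (hI : ∀ i t, I t → ∀ u ∈ (step i t).support, I u)
    (hE : ∀ i t, I t → t ∉ E → ∀ u ∈ (step i t).support, u ∉ E)
    (hθ : ∀ i t, I t → (step i t).toOuterMeasure E ≤ θ) :
    (iterate step k s).toOuterMeasure E ≤ θ ^ k := by
  induction k with
  | zero => rw [pow_zero]; exact toOuterMeasure_le_one _ _
  | succ k ih =>
    have hIk := iterate_support_invariant (fun _ => I) k h0 (fun i _ => hI i)
    refine (toOuterMeasure_bind_le _ _ E E θ (fun t ht _ => hθ k t (hIk t ht))
      fun t ht htE => ?_).trans (by rw [pow_succ]; gcongr)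
    rw [PMF.toOuterMeasure_apply_eq_zero_iff]
    exact Set.disjoint_left.2 (hE k t (hIk t ht) htE)

/-! ### Weakest preconditions and frames -/

section Wp

variable [Field K] [Fintype K]

/-- The weakest precondition: started in the state `s`, the program `A` ends with certainty in a
state that satisfies `Q`. -/
def Prog.wp (A : Prog) (s : State K) (Q : State K → Prop) : Prop :=
  ∀ t ∈ (A.run s).support, Q t

theorem Prog.wp.mono {A : Prog} {s : State K} {Q Q' : State K → Prop} (h : A.wp s Q)
    (hQ : ∀ t, Q t → Q' t) : A.wp s Q' :=
  fun t ht => hQ t (h t ht)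

theorem Prog.wp.and {A : Prog} {s : State K} {Q Q' : State K → Prop} (h : A.wp s Q)
    (h' : A.wp s Q') : A.wp s (fun t => Q t ∧ Q' t) :=
  fun t ht => ⟨h t ht, h' t ht⟩

theorem wp_skip (s : State K) (Q : State K → Prop) : Prog.skip.wp s Q ↔ Q s := by
  simp [Prog.wp, Prog.run]

theorem wp_seq (A B : Prog) (s : State K) (Q : State K → Prop) :
    (Prog.seq A B).wp s Q ↔ A.wp s (fun t => B.wp t Q) := by
  simp only [Prog.wp, Prog.run, PMF.mem_support_bind_iff]
  exact ⟨fun h t ht u hu => h u ⟨t, ht, hu⟩, fun h u ⟨t, ht, hu⟩ => h t ht u hu⟩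

theorem wp_setInt (a : ℕ) (i e : IntExpr) (s : State K) (Q : State K → Prop) :
    (Prog.setInt a i e).wp s Q ↔ Q (s.putInt a (i.eval s.int) (e.eval s.int)) := by
  simp [Prog.wp, Prog.run]

theorem wp_setField (x : FieldRef) (e : FieldExpr) (s : State K) (Q : State K → Prop) :
    (Prog.setField x e).wp s Q ↔ Q (s.putField x (e.eval s)) := by
  simp [Prog.wp, Prog.run]

theorem wp_drawField (x : FieldRef) (s : State K) (Q : State K → Prop) :
    (Prog.drawField x).wp s Q ↔ ∀ v, Q (s.putField x v) := by
  simp [Prog.wp, Prog.run]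

theorem wp_drawBit (x : FieldRef) (s : State K) (Q : State K → Prop) :
    (Prog.drawBit x).wp s Q ↔ ∀ b : Bool, Q (s.putField x (if b then 1 else 0)) := by
  simp [Prog.wp, Prog.run, or_imp, forall_and]

theorem wp_ifInt (e : IntExpr) (A B : Prog) (s : State K) (Q : State K → Prop) :
    (Prog.ifInt e A B).wp s Q ↔
      (e.eval s.int = 0 → A.wp s Q) ∧ (e.eval s.int ≠ 0 → B.wp s Q) := by
  by_cases h : e.eval s.int = 0 <;> simp [Prog.wp, Prog.run, h]

theorem wp_ifField (x : FieldRef) (A B : Prog) (s : State K) (Q : State K → Prop) :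
    (Prog.ifField x A B).wp s Q ↔
      (x.get s = 0 → A.wp s.tick Q) ∧ (x.get s ≠ 0 → B.wp s.tick Q) := by
  by_cases h : x.get s = 0 <;> simp [Prog.wp, Prog.run, h]

/-- The invariant rule for loops. -/
theorem wp_loop {c : ℕ} {e : IntExpr} {A : Prog} {s : State K} {Q : State K → Prop}
    (I : ℕ → State K → Prop) (h0 : I 0 s)
    (hstep : ∀ i < e.eval s.int, ∀ t, I i t → A.wp (t.putInt c 0 i) (I (i + 1)))
    (hQ : ∀ t, I (e.eval s.int) t → Q t) : (Prog.loop c e A).wp s Q := fun t ht =>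
  hQ t (iterate_support_invariant I _ h0 (fun i hi t h u hu => hstep i hi t h u hu) t ht)

end Wp

/-- The program assigns to the integer array `a`. -/
def Prog.WritesInt (a : ℕ) : Prog → Prop
  | .skip => False
  | .seq A B => A.WritesInt a ∨ B.WritesInt a
  | .setInt b _ _ => a = b
  | .setField _ _ => False
  | .drawField _ => False
  | .drawBit _ => False
  | .ifInt _ A B => A.WritesInt a ∨ B.WritesInt a
  | .ifField _ A B => A.WritesInt a ∨ B.WritesInt a
  | .loop c _ A => a = c ∨ A.WritesInt a

/-- The program assigns to the field array `a`. -/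
def Prog.WritesFld (a : ℕ) : Prog → Prop
  | .skip => False
  | .seq A B => A.WritesFld a ∨ B.WritesFld a
  | .setInt _ _ _ => False
  | .setField x _ => a = x.arr
  | .drawField x => a = x.arr
  | .drawBit x => a = x.arr
  | .ifInt _ A B => A.WritesFld a ∨ B.WritesFld a
  | .ifField _ A B => A.WritesFld a ∨ B.WritesFld a
  | .loop _ _ A => A.WritesFld a

/-! ### Drawing a vector -/

/-- The program that fills the entries `1, …, e` of the field array `a` with random elements. -/
def drawVec (c a : ℕ) (e : IntExpr) : Prog :=
  .loop c e (.drawField ⟨a, .add (.cell c (.const 0)) (.const 1)⟩)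

/-- The state after `k` rounds of `drawVec` in which the vector `r` has been drawn. -/
def drawState (c a : ℕ) : (k : ℕ) → (Fin k → K) → State K → State K
  | 0, _, s => s
  | k + 1, r, s => ((drawState c a k (Fin.init r) s).putInt c 0 k).putField
      ⟨a, .add (.cell c (.const 0)) (.const 1)⟩ (r (Fin.last k))

theorem drawState_int {c a b : ℕ} (hb : b ≠ c) (k : ℕ) (r : Fin k → K) (s : State K) :
    (drawState c a k r s).int b = s.int b := by
  induction k with
  | zero => rfl
  | succ k ih => simp [drawState, State.putInt, State.putField, write_of_ne _ hb, ih]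

theorem drawState_fld_of_ne {c a b : ℕ} (hb : b ≠ a) (k : ℕ) (r : Fin k → K) (s : State K) :
    (drawState c a k r s).fld b = s.fld b := by
  induction k with
  | zero => rfl
  | succ k ih => simp [drawState, State.putInt, State.putField, write_of_ne _ hb, ih]

theorem drawState_fld (c a : ℕ) (k : ℕ) (r : Fin k → K) (s : State K) (i : Fin k) :
    (drawState c a k r s).fld a (i + 1) = r i := by
  induction k with
  | zero => exact i.elim0
  | succ k ih =>
    simp only [drawState, State.putInt, State.putField, IntExpr.eval, write_apply, and_self,
      if_true, true_and]
    refine Fin.lastCases ?_ (fun j => ?_) i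
    · simp
    · simp [ih, Fin.init, j.2.ne]

theorem drawState_ops (c a : ℕ) (k : ℕ) (r : Fin k → K) (s : State K) :
    (drawState c a k r s).ops = s.ops + k := by
  induction k with
  | zero => rfl
  | succ k ih => simp [drawState, State.putInt, State.putField, ih]; omega

variable [Field K] [Fintype K]

theorem wp_int_frame {a : ℕ} (A : Prog) (h : ¬ A.WritesInt a) (s : State K) :
    A.wp s (fun t => t.int a = s.int a) := by
  induction A generalizing s with
  | skip => simp [wp_skip]
  | seq A B hA hB =>
    simp only [Prog.WritesInt, not_or] at h
    rw [wp_seq]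
    exact (hA h.1 s).mono fun t ht => (hB h.2 t).mono fun u hu => hu.trans ht
  | setInt b i e => simpa [wp_setInt, State.putInt] using write_of_ne _ h _ _
  | setField x e => simp [wp_setField, State.putField]
  | drawField x => simp [wp_drawField, State.putField]
  | drawBit x => simp [wp_drawBit, State.putField]
  | ifInt e A B hA hB =>
    simp only [Prog.WritesInt, not_or] at h
    rw [wp_ifInt]
    exact ⟨fun _ => hA h.1 s, fun _ => hB h.2 s⟩
  | ifField e A B hA hB =>
    simp only [Prog.WritesInt, not_or] at h
    rw [wp_ifField]
    exact ⟨fun _ => hA h.1 s.tick, fun _ => hB h.2 s.tick⟩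
  | loop c e A hA =>
    simp only [Prog.WritesInt, not_or] at h
    refine wp_loop (fun _ t => t.int a = s.int a) rfl (fun i _ t ht => ?_) (fun t ht => ht)
    refine (hA h.2 _).mono fun u hu => hu.trans ?_
    simpa [State.putInt, write_of_ne _ h.1] using ht

theorem wp_fld_frame {a : ℕ} (A : Prog) (h : ¬ A.WritesFld a) (s : State K) :
    A.wp s (fun t => t.fld a = s.fld a) := by
  induction A generalizing s with
  | skip => simp [wp_skip]
  | seq A B hA hB =>
    simp only [Prog.WritesFld, not_or] at h
    rw [wp_seq]
    exact (hA h.1 s).mono fun t ht => (hB h.2 t).mono fun u hu => hu.trans ht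
  | setInt b i e => simp [wp_setInt, State.putInt]
  | setField x e => simpa [wp_setField, State.putField] using write_of_ne _ h _ _
  | drawField x =>
    simpa [wp_drawField, State.putField] using fun v => write_of_ne _ h _ _
  | drawBit x =>
    rw [wp_drawBit]
    exact fun b => write_of_ne _ h _ _
  | ifInt e A B hA hB =>
    simp only [Prog.WritesFld, not_or] at h
    rw [wp_ifInt]
    exact ⟨fun _ => hA h.1 s, fun _ => hB h.2 s⟩
  | ifField e A B hA hB =>
    simp only [Prog.WritesFld, not_or] at h
    rw [wp_ifField]
    exact ⟨fun _ => hA h.1 s.tick, fun _ => hB h.2 s.tick⟩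
  | loop c e A hA =>
    refine wp_loop (fun _ t => t.fld a = s.fld a) rfl (fun i _ t ht => ?_) (fun t ht => ht)
    exact (hA h _).mono fun u hu => hu.trans ht

/-- Arrays that a program does not write are unchanged. -/
theorem wp_frame (A : Prog) (s : State K) :
    A.wp s fun t => (∀ a, ¬ A.WritesInt a → t.int a = s.int a) ∧
      (∀ a, ¬ A.WritesFld a → t.fld a = s.fld a) := fun t ht =>
  ⟨fun _ h => wp_int_frame A h s t ht, fun _ h => wp_fld_frame A h s t ht⟩

/-- The invariant rule for loops, in which the arrays that the loop does not touch are known to be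
unchanged. -/
theorem wp_loop_frame {c : ℕ} {e : IntExpr} {A : Prog} {s : State K} {Q : State K → Prop}
    (I : ℕ → State K → Prop) (h0 : I 0 s)
    (hstep : ∀ i < e.eval s.int, ∀ t, I i t →
      (∀ a, ¬ (Prog.loop c e A).WritesInt a → t.int a = s.int a) →
      (∀ a, ¬ A.WritesFld a → t.fld a = s.fld a) → A.wp (t.putInt c 0 i) (I (i + 1)))
    (hQ : ∀ t, I (e.eval s.int) t →
      (∀ a, ¬ (Prog.loop c e A).WritesInt a → t.int a = s.int a) →
      (∀ a, ¬ A.WritesFld a → t.fld a = s.fld a) → Q t) : (Prog.loop c e A).wp s Q := by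
  refine wp_loop (fun i t => I i t ∧
    (∀ a, ¬ (Prog.loop c e A).WritesInt a → t.int a = s.int a) ∧
    (∀ a, ¬ A.WritesFld a → t.fld a = s.fld a)) ⟨h0, fun _ _ => rfl, fun _ _ => rfl⟩
    (fun i hi t ht => ?_) (fun t ht => hQ t ht.1 ht.2.1 ht.2.2)
  intro u hu
  refine ⟨hstep i hi t ht.1 ht.2.1 ht.2.2 u hu, fun a ha => ?_, fun a ha => ?_⟩
  · have ha' := ha
    simp only [Prog.WritesInt, not_or] at ha'
    rw [wp_int_frame A ha'.2 _ u hu, ← ht.2.1 a ha]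
    exact write_of_ne _ ha'.1 _ _
  · rw [wp_fld_frame A ha _ u hu, ← ht.2.2 a ha]
    rfl

/-! ### Probabilities of events -/

/-- The probability that the program ends in the event `E`. -/
noncomputable def Prog.prob (A : Prog) (s : State K) (E : Set (State K)) : ℝ≥0∞ :=
  (A.run s).toOuterMeasure E


theorem prob_eq_zero {A : Prog} {s : State K} {E : Set (State K)} (h : A.wp s (fun t => t ∉ E)) :
    A.prob s E = 0 := by
  rw [Prog.prob, PMF.toOuterMeasure_apply_eq_zero_iff]
  exact Set.disjoint_left.2 h

theorem prob_seq_le {A B : Prog} {s : State K} {E : Set (State K)} {θ : ℝ≥0∞}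
    (h : A.wp s (fun t => B.prob t E ≤ θ)) : (Prog.seq A B).prob s E ≤ θ := by
  refine (toOuterMeasure_bind_le (A.run s) B.run E Set.univ θ (fun t ht _ => h t ht)
    (fun t _ ht => absurd trivial ht)).trans ?_
  calc _ ≤ 1 * θ := by gcongr; exact toOuterMeasure_le_one _ _
    _ = θ := one_mul θ

/-! ### The distribution of a drawn vector -/

theorem drawVec_run (c a : ℕ) (e : IntExpr) (s : State K) :
    (drawVec c a e).run s = (PMF.uniformOfFintype (Fin (e.eval s.int) → K)).map
      (fun r => drawState c a _ r s) := by
  simp only [drawVec, Prog.run]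
  generalize e.eval s.int = k
  induction k with
  | zero =>
    simp only [iterate, drawState]
    exact (PMF.map_const _ _).symm
  | succ k ih =>
    simp only [iterate, ih, PMF.bind_map, Function.comp_def]
    -- a uniform vector is a uniform initial segment followed by a uniform last entry
    have key : PMF.uniformOfFintype (Fin (k + 1) → K) =
        (PMF.uniformOfFintype (Fin k → K)).bind fun r =>
          (PMF.uniformOfFintype K).map (fun v => (Fin.snoc r v : Fin (k + 1) → K)) := by
      classical
      ext w
      simp only [PMF.bind_apply, PMF.map_apply, PMF.uniformOfFintype_apply, tsum_fintype]
      rw [Finset.sum_eq_single (Fin.init w), Finset.sum_eq_single (w (Fin.last k))]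
      · simp only [Fin.snoc_init_self, if_true, Fintype.card_fun, Fintype.card_fin]
        rw [← ENNReal.mul_inv (by simp) (by simp)]
        push_cast
        rw [pow_succ]
      · intro v _ hv
        rw [if_neg]
        rintro h
        exact hv (by rw [h]; simp)
      · simp
      · intro r _ hr
        rw [Finset.sum_eq_zero, mul_zero]
        intro v _
        rw [if_neg]
        rintro h
        exact hr (by rw [h]; simp)
      · simp
    rw [key, PMF.map_bind]
    congr 1
    funext r
    rw [PMF.map_comp]
    simp [Function.comp_def, drawState]

open Classical in
/-- Drawing a vector first, the probability of `E` is at most the proportion of the vectors `r` from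
which `E` is reachable at all. -/
theorem prob_drawVec_seq_le (c a : ℕ) (e : IntExpr) (A : Prog) (s : State K) (E : Set (State K))
    (B : Finset (Fin (e.eval s.int) → K))
    (h : ∀ r ∉ B, A.wp (drawState c a _ r s) (fun t => t ∉ E)) :
    (Prog.seq (drawVec c a e) A).prob s E ≤
      (B.card : ℝ≥0∞) / (Fintype.card K : ℝ≥0∞) ^ (e.eval s.int) := by
  simp only [Prog.prob, Prog.run, drawVec_run, PMF.bind_map, Function.comp_def]
  refine (toOuterMeasure_bind_le _ _ E (B : Set _) 1
    (fun r _ _ => toOuterMeasure_le_one _ _) (fun r _ hr => prob_eq_zero (h r hr))).trans ?_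
  rw [PMF.toOuterMeasure_uniformOfFintype_apply]
  simp

end

section

/-! ### Arithmetic modulo a monic polynomial -/

/-- The integer variable number `a`, kept in entry `0` of the integer array `a`. -/
abbrev var (a : ℕ) : IntExpr := .cell a (.const 0)

/-- Fill the entries `0, …, d` of the field array `a` with zeros; `d` is the integer variable
`5`. -/
def zeroVec (a : ℕ) : Prog :=
  .loop 20 (.add (var 5) (.const 1)) (.setField ⟨a, var 20⟩ .zero)

/-- Store the residue class of `1` in the field array `a`. -/
def oneVec (a : ℕ) : Prog :=
  .seq (zeroVec a) (.setField ⟨a, .const 1⟩ .one)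

/-- One round of `pass` for one coordinate.  The coordinates are treated from the last one to the
first, so that the entry below the current one still has its old value when it is shifted up.  The
entry `1` of the field array `11` holds the old top coordinate of `γ`. -/
def passBody (f c γ π acc : ℕ) : Prog :=
  .seq (.setField ⟨11, .const 0⟩ (.mul ⟨f, var 20⟩ ⟨γ, .sub (var 5) (var 21)⟩)) <|
  .seq (.setField ⟨acc, .sub (var 5) (var 21)⟩
    (.sub ⟨acc, .sub (var 5) (var 21)⟩ ⟨11, .const 0⟩)) <|
  .seq (.setField ⟨11, .const 0⟩ (.mul ⟨11, .const 1⟩ ⟨7, .sub (var 5) (var 21)⟩)) <|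
  .seq (.setField ⟨γ, .sub (var 5) (var 21)⟩
    (.sub ⟨γ, .sub (.sub (var 5) (var 21)) (.const 1)⟩ ⟨11, .const 0⟩)) <|
  .seq (.setField ⟨11, .const 0⟩ (.mul ⟨c, var 20⟩ ⟨π, .sub (var 5) (var 21)⟩))
    (.setField ⟨γ, .sub (var 5) (var 21)⟩ (.sub ⟨γ, .sub (var 5) (var 21)⟩ ⟨11, .const 0⟩))

/-- For `i = 0, …, n`, with vectors standing for residue classes modulo the monic polynomial in the
field array `7`: subtract `f i • γ` from `acc` and then replace `γ` by `X * γ - c i • π`. -/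
def pass (f c γ π acc : ℕ) : Prog :=
  .loop 20 (.add (.cell 0 (.const 1)) (.const 1)) <|
    .seq (.setField ⟨11, .const 1⟩ (.copy ⟨γ, var 5⟩)) <|
      .loop 21 (var 5) (passBody f c γ π acc)

/-- The residue class stored in a field array `v`: the coordinates with respect to the powers of `x`
are the entries `1, …, d`.  Entry `0` is kept zero, so that a multiplication by `x` shifts a zero
into the lowest coordinate. -/
def val {K S : Type*} [Field K] [CommRing S] [Algebra K S] (x : S) (d : ℕ) (v : ℕ → K) : S :=
  ∑ j ∈ Finset.range d, v (j + 1) • x ^ j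

/-- The sequence with `Γ 0 = γ` and `Γ (i + 1) = x * Γ i - c i • π`. -/
def resSeq {K S : Type*} [Field K] [CommRing S] [Algebra K S] (x : S) (c : ℕ → K) (γ π : S) :
    ℕ → S
  | 0 => γ
  | i + 1 => x * resSeq x c γ π i - c i • π

/-- Multiplication by `x` in coordinates: shift, and replace `x ^ d` by lower powers. -/
theorem val_shift {K S : Type*} [Field K] [CommRing S] [Algebra K S] {x : S} {d : ℕ}
    {r v w p : ℕ → K} {b : K} (hx : x ^ d = - val x d r) (hv : v 0 = 0)
    (hw : ∀ m, 0 < m → m ≤ d → w m = v (m - 1) - v d * r m - b * p m) :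
    val x d w = x * val x d v - b • val x d p := by
  have h1 : val x d w = ∑ j ∈ Finset.range d, v j • x ^ j - v d • val x d r - b • val x d p := by
    simp only [val, Finset.smul_sum, ← Finset.sum_sub_distrib]
    refine Finset.sum_congr rfl fun j hj => ?_
    rw [hw (j + 1) j.succ_pos (Finset.mem_range.1 hj)]
    simp [sub_smul, mul_smul]
  have h2 : x * val x d v = ∑ j ∈ Finset.range d, v j • x ^ j + v d • x ^ d := by
    rw [← Finset.sum_range_succ, Finset.sum_range_succ', hv, zero_smul, add_zero, val,
      Finset.mul_sum]
    exact Finset.sum_congr rfl fun j _ => by rw [mul_smul_comm, pow_succ']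
  rw [h1, h2, hx, smul_neg, ← sub_eq_add_neg]

variable {K : Type u} [Field K] [Fintype K]

theorem wp_zeroVec (a : ℕ) (s : State K) :
    (zeroVec a).wp s fun t => (∀ m ≤ s.int 5 0, t.fld a m = 0) ∧
      t.ops = s.ops + (s.int 5 0 + 1) := by
  refine wp_loop_frame (fun i t => (∀ m < i, t.fld a m = 0) ∧ t.ops = s.ops + i) (by simp)
    (fun i _ t ht _ _ => ?_) (fun t ht _ _ => ?_)
  · rw [wp_setField]
    refine ⟨fun m hm => ?_, by simp [State.putField, State.putInt, ht.2, add_assoc]⟩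
    simp only [State.putField, State.putInt, IntExpr.eval, FieldExpr.eval, write_apply, true_and,
      and_self, if_true]
    split_ifs with h
    · rfl
    · exact ht.1 m (by omega)
  · simp only [IntExpr.eval] at ht
    exact ⟨fun m hm => ht.1 m (by omega), ht.2⟩

theorem wp_zeroVec_val {S : Type*} [CommRing S] [Algebra K S] (x : S) (a : ℕ) (s : State K) :
    (zeroVec a).wp s fun t => t.fld a 0 = 0 ∧ val x (s.int 5 0) (t.fld a) = 0 ∧
      t.ops = s.ops + (s.int 5 0 + 1) := by
  refine (wp_zeroVec a s).mono fun t ht => ⟨ht.1 0 (Nat.zero_le _), ?_, ht.2⟩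
  exact Finset.sum_eq_zero fun j hj => by
    rw [ht.1 (j + 1) (Finset.mem_range.1 hj), zero_smul]

theorem wp_oneVec_val {S : Type*} [CommRing S] [Algebra K S] (x : S) (a : ℕ) (s : State K)
    (hd : 0 < s.int 5 0) :
    (oneVec a).wp s fun t => t.fld a 0 = 0 ∧ val x (s.int 5 0) (t.fld a) = 1 ∧
      t.ops = s.ops + (s.int 5 0 + 2) := by
  rw [oneVec, wp_seq]
  refine (wp_zeroVec a s).mono fun t ht => ?_
  rw [wp_setField]
  refine ⟨?_, ?_, ?_⟩
  · simp [State.putField, write_apply, IntExpr.eval, ht.1]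
  · rw [val, Finset.sum_eq_single_of_mem 0 (Finset.mem_range.2 hd)]
    · simp [State.putField, write_apply, IntExpr.eval, FieldExpr.eval]
    · intro j hj h0
      have := ht.1 (j + 1) (Finset.mem_range.1 hj)
      simp [State.putField, write_apply, IntExpr.eval, h0, this]
  · simp [State.putField, ht.2, add_assoc]

/-- The effect of one round of `pass`, coordinate by coordinate. -/
theorem wp_passBody {f c γ π acc : ℕ} (hγ : γ ∉ [f, c, π, acc, 7, 11]) (ha : acc ∉ [f, c, π, 7, 11])
    (h11 : 11 ∉ [f, c, π]) (s : State K) :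
    (Prog.loop 21 (var 5) (passBody f c γ π acc)).wp s fun t =>
      (∀ m, 0 < m → m ≤ s.int 5 0 → t.fld γ m =
        s.fld γ (m - 1) - s.fld 11 1 * s.fld 7 m - s.fld c (s.int 20 0) * s.fld π m) ∧
      (∀ m, 0 < m → m ≤ s.int 5 0 → t.fld acc m =
        s.fld acc m - s.fld f (s.int 20 0) * s.fld γ m) ∧
      t.fld γ 0 = s.fld γ 0 ∧ t.fld acc 0 = s.fld acc 0 ∧ t.ops = s.ops + 6 * s.int 5 0 := by
  simp only [List.mem_cons, List.not_mem_nil, or_false, not_or] at hγ ha h11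
  obtain ⟨hγf, hγc, hγπ, hγa, hγ7, hγ11⟩ := hγ
  obtain ⟨haf, hac, haπ, ha7, ha11⟩ := ha
  obtain ⟨hf, hc, hπ⟩ := h11
  set d := s.int 5 0 with hd
  refine wp_loop_frame (fun j t =>
      (∀ m, t.fld γ m = if d - j < m ∧ m ≤ d then
        s.fld γ (m - 1) - s.fld 11 1 * s.fld 7 m - s.fld c (s.int 20 0) * s.fld π m
        else s.fld γ m) ∧
      (∀ m, t.fld acc m = if d - j < m ∧ m ≤ d then
        s.fld acc m - s.fld f (s.int 20 0) * s.fld γ m else s.fld acc m) ∧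
      t.fld 11 1 = s.fld 11 1 ∧ t.ops = s.ops + 6 * j) ?_ (fun j hj t ht hti htf => ?_)
      (fun t ht _ _ => ?_)
  · refine ⟨fun m => ?_, fun m => ?_, rfl, rfl⟩
    · rw [if_neg (by omega)]
    · rw [if_neg (by omega)]
  · obtain ⟨h1, h2, h3, h4⟩ := ht
    simp only [IntExpr.eval, ← hd] at hj
    have i5 : t.int 5 = s.int 5 := hti 5 (by simp [Prog.WritesInt, passBody])
    have i20 : t.int 20 = s.int 20 := hti 20 (by simp [Prog.WritesInt, passBody])
    have f7 : t.fld 7 = s.fld 7 := htf 7 (by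
      simp [Prog.WritesFld, passBody, Ne.symm hγ7, Ne.symm ha7])
    have ff : t.fld f = s.fld f := htf f (by
      simp [Prog.WritesFld, passBody, Ne.symm hγf, Ne.symm haf, Ne.symm hf])
    have fc : t.fld c = s.fld c := htf c (by
      simp [Prog.WritesFld, passBody, Ne.symm hγc, Ne.symm hac, Ne.symm hc])
    have fp : t.fld π = s.fld π := htf π (by
      simp [Prog.WritesFld, passBody, Ne.symm hγπ, Ne.symm haπ, Ne.symm hπ])
    have eγ : t.fld γ (d - j) = s.fld γ (d - j) := by rw [h1, if_neg (by omega)]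
    have eγ' : t.fld γ (d - j - 1) = s.fld γ (d - j - 1) := by rw [h1, if_neg (by omega)]
    have eacc : t.fld acc (d - j) = s.fld acc (d - j) := by rw [h2, if_neg (by omega)]
    simp only [passBody, wp_seq, wp_setField]
    have hne : d - j - 1 ≠ d - j := by omega
    simp only [State.putField, State.putInt, IntExpr.eval, FieldExpr.eval, FieldRef.get,
      write_apply, i5, i20, f7, ff, fc, fp, ← hd, eγ, eγ', eacc, h3, h4, and_true, true_and,
      and_self, if_true, if_false, false_and, and_false, hγa, hγ11, ha11, Ne.symm hγc, Ne.symm hγπ,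
      Ne.symm hγa, Ne.symm hγ11, Ne.symm hac, Ne.symm haπ, Ne.symm ha7, Ne.symm ha11, Ne.symm hc,
      Ne.symm hπ, hne, Nat.reduceEqDiff, one_ne_zero]
    refine ⟨fun m => ?_, fun m => ?_, ?_⟩
    · by_cases hm : m = d - j
      · rw [if_pos hm, if_pos (by omega), hm]
      · simp only [if_neg hm]
        rw [h1]
        congr 1
        exact propext ⟨fun h => by omega, fun h => by omega⟩
    · by_cases hm : m = d - j
      · rw [if_pos hm, if_pos (by omega), hm]
      · simp only [if_neg hm]
        rw [h2]
        congr 1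
        exact propext ⟨fun h => by omega, fun h => by omega⟩
    · omega
  · simp only [IntExpr.eval, ← hd, Nat.sub_self] at ht
    obtain ⟨h1, h2, h3, h4⟩ := ht
    refine ⟨fun m hm hm' => ?_, fun m hm hm' => ?_, ?_, ?_, h4⟩
    · rw [h1, if_pos ⟨hm, hm'⟩]
    · rw [h2, if_pos ⟨hm, hm'⟩]
    · rw [h1, if_neg (by omega)]
    · rw [h2, if_neg (by omega)]

/-- The effect of `pass`, in terms of residue classes. -/
theorem wp_pass {S : Type*} [CommRing S] [Algebra K S] {x : S} {f c γ π acc : ℕ}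
    (hγ : γ ∉ [f, c, π, acc, 7, 11]) (ha : acc ∉ [f, c, π, 7, 11])
    (h11 : 11 ∉ [f, c, π]) (s : State K)
    (hx : x ^ s.int 5 0 = - val x (s.int 5 0) (s.fld 7)) (h0 : s.fld γ 0 = 0) :
    (pass f c γ π acc).wp s fun t =>
      val x (s.int 5 0) (t.fld acc) = val x (s.int 5 0) (s.fld acc) -
        ∑ i ∈ Finset.range (s.int 0 1 + 1), s.fld f i •
          resSeq x (s.fld c) (val x (s.int 5 0) (s.fld γ)) (val x (s.int 5 0) (s.fld π)) i ∧
      t.fld acc 0 = s.fld acc 0 ∧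
      t.ops = s.ops + (s.int 0 1 + 1) * (1 + 6 * s.int 5 0) := by
  have hγ' := hγ
  have ha' := ha
  have h11' := h11
  simp only [List.mem_cons, List.not_mem_nil, or_false, not_or] at hγ ha h11
  obtain ⟨hγf, hγc, hγπ, hγa, hγ7, hγ11⟩ := hγ
  obtain ⟨haf, hac, haπ, ha7, ha11⟩ := ha
  obtain ⟨hf, hc, hπ⟩ := h11
  set d := s.int 5 0 with hd
  set Γ := resSeq x (s.fld c) (val x d (s.fld γ)) (val x d (s.fld π)) with hΓ
  refine wp_loop_frame (fun i t => t.fld γ 0 = 0 ∧ val x d (t.fld γ) = Γ i ∧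
      val x d (t.fld acc) = val x d (s.fld acc) - ∑ l ∈ Finset.range i, s.fld f l • Γ l ∧
      t.fld acc 0 = s.fld acc 0 ∧ t.ops = s.ops + i * (1 + 6 * d))
      (by simp [h0, hΓ, resSeq]) (fun i hi t ht hti htf => ?_)
      (fun t ht _ _ => ⟨ht.2.2.1, ht.2.2.2.1, ht.2.2.2.2⟩)
  obtain ⟨g1, g2, g3, g4, g5⟩ := ht
  have i5 : t.int 5 = s.int 5 := hti 5 (by simp [Prog.WritesInt, passBody])
  have f7 : t.fld 7 = s.fld 7 := htf 7 (by
    simp [Prog.WritesFld, passBody, Ne.symm hγ7, Ne.symm ha7])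
  have ff : t.fld f = s.fld f := htf f (by
    simp [Prog.WritesFld, passBody, Ne.symm hγf, Ne.symm haf, Ne.symm hf])
  have fc : t.fld c = s.fld c := htf c (by
    simp [Prog.WritesFld, passBody, Ne.symm hγc, Ne.symm hac, Ne.symm hc])
  have fp : t.fld π = s.fld π := htf π (by
    simp [Prog.WritesFld, passBody, Ne.symm hγπ, Ne.symm haπ, Ne.symm hπ])
  rw [wp_seq, wp_setField]
  refine (wp_passBody hγ' ha' h11' _).mono fun u hu => ?_
  simp only [State.putField, State.putInt, IntExpr.eval, FieldExpr.eval, FieldRef.get,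
    write_apply, i5, f7, ff, fc, fp, ← hd, and_true, and_self, if_true, if_false, false_and, hγ11,
    ha11, Ne.symm hf, Ne.symm hc, Ne.symm hπ, Nat.reduceEqDiff] at hu
  obtain ⟨u1, u2, u3, u4, u5⟩ := hu
  refine ⟨u3.trans g1, ?_, ?_, u4.trans g4, ?_⟩
  · rw [val_shift hx g1 u1, g2]
    rfl
  · rw [Finset.sum_range_succ, ← sub_sub, ← g3, ← g2]
    simp only [val, Finset.smul_sum, ← Finset.sum_sub_distrib]
    refine Finset.sum_congr rfl fun j hj => ?_
    rw [u2 (j + 1) j.succ_pos (Finset.mem_range.1 hj), sub_smul, mul_smul]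
  · rw [u5, g5]; ring

end

section

open Polynomial

/-! ### Reduction modulo `P` by shifting -/

section Algebra

variable {K : Type u} [Field K]

/-- The remainders `X ^ i * G mod P`, each one obtained from the one before by a multiplication
with `X` and the subtraction of a scalar multiple of `P`. -/
noncomputable def shiftRem (P G : K[X]) : ℕ → K[X]
  | 0 => G
  | i + 1 => X * shiftRem P G i - C ((shiftRem P G i).coeff (P.natDegree - 1)) * P

theorem shiftRem_degree_lt {P G : K[X]} (hP : P.Monic) (hn : 1 ≤ P.natDegree)
    (hG : G.degree < P.natDegree) (i : ℕ) : (shiftRem P G i).degree < P.natDegree := by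
  induction i with
  | zero => exact hG
  | succ i ih =>
    rw [degree_lt_iff_coeff_zero] at ih ⊢
    intro m hm
    obtain ⟨m, rfl⟩ : ∃ l, m = l + 1 := ⟨m - 1, by omega⟩
    rw [shiftRem, coeff_sub, coeff_X_mul, coeff_C_mul]
    rcases hm.eq_or_lt with h | h
    · rw [← h, h, Nat.add_sub_cancel, ← h, coeff_natDegree, hP.leadingCoeff, mul_one, sub_self]
    · rw [ih m (by omega), coeff_eq_zero_of_natDegree_lt h, mul_zero, sub_zero]

theorem dvd_X_pow_mul_sub_shiftRem (P G : K[X]) (i : ℕ) : P ∣ X ^ i * G - shiftRem P G i := by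
  induction i with
  | zero => simp [shiftRem]
  | succ i ih =>
    have : X ^ (i + 1) * G - shiftRem P G (i + 1) = X * (X ^ i * G - shiftRem P G i) +
        C ((shiftRem P G i).coeff (P.natDegree - 1)) * P := by
      rw [shiftRem]; ring
    rw [this]
    exact dvd_add (dvd_mul_of_dvd_right ih _) (dvd_mul_left _ _)

/-- The product modulo `P` is the combination of the shifted remainders of one factor with the
coefficients of the other factor. -/
theorem sum_coeff_mul_shiftRem {P F G : K[X]} (hP : P.Monic) (hn : 1 ≤ P.natDegree)
    (hF : F.degree < P.natDegree) (hG : G.degree < P.natDegree) :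
    ∑ i ∈ Finset.range (P.natDegree + 1), C (F.coeff i) * shiftRem P G i =
      (F * G).modByMonic P := by
  have hdvd : P ∣ F * G -
      ∑ i ∈ Finset.range (P.natDegree + 1), C (F.coeff i) * shiftRem P G i := by
    have hF' : F.natDegree < P.natDegree + 1 :=
      Nat.lt_succ_of_le (natDegree_le_of_degree_le hF.le)
    conv_rhs => enter [1]; rw [F.as_sum_range_C_mul_X_pow' hF', Finset.sum_mul]
    rw [← Finset.sum_sub_distrib]
    refine Finset.dvd_sum fun i _ => ?_
    rw [mul_assoc, ← mul_sub]
    exact dvd_mul_of_dvd_right (dvd_X_pow_mul_sub_shiftRem P G i) _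
  obtain ⟨q, hq⟩ := hdvd
  refine ((div_modByMonic_unique q _ hP ⟨?_, ?_⟩).2).symm
  · rw [← hq]; ring
  · rw [degree_eq_natDegree hP.ne_zero]
    have hmem : ∑ i ∈ Finset.range (P.natDegree + 1), C (F.coeff i) * shiftRem P G i ∈
        degreeLT K P.natDegree := by
      refine Submodule.sum_mem _ fun i _ => ?_
      rw [← smul_eq_C_mul]
      exact Submodule.smul_mem _ _ (mem_degreeLT.2 (shiftRem_degree_lt hP hn hG i))
    exact mem_degreeLT.1 hmem

/-- The monic polynomial of degree `d` with the lower coefficients `r`. -/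
noncomputable def monicOf {d : ℕ} (r : Fin d → K) : K[X] :=
  X ^ d + ∑ i : Fin d, C (r i) * X ^ (i : ℕ)

theorem monicOf_monic {d : ℕ} (r : Fin d → K) : (monicOf r).Monic :=
  monic_X_pow_add (degree_sum_fin_lt r)

theorem monicOf_natDegree {d : ℕ} (r : Fin d → K) : (monicOf r).natDegree = d := by
  refine natDegree_eq_of_degree_eq_some ?_
  rw [monicOf, degree_add_eq_left_of_degree_lt, degree_X_pow]
  rw [degree_X_pow]
  exact degree_sum_fin_lt r

theorem monicOf_coeff_eq {d : ℕ} {R : K[X]} (hR : R.Monic) (hd : R.natDegree = d) :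
    monicOf (fun i : Fin d => R.coeff i) = R := by
  rw [monicOf, Fin.sum_univ_eq_sum_range (fun i => C (R.coeff i) * X ^ i), ← hd]
  exact hR.as_sum.symm

theorem monicOf_injective (d : ℕ) : Function.Injective (monicOf : (Fin d → K) → K[X]) := by
  intro r r' h
  funext i
  have := congrArg (fun q : K[X] => q.coeff i) h
  simpa [monicOf, coeff_X_pow, i.2.ne, Fin.val_inj] using this

theorem root_monicOf_pow {d : ℕ} (r : Fin d → K) (v : ℕ → K) (hv : ∀ i : Fin d, v (i + 1) = r i) :
    AdjoinRoot.root (monicOf r) ^ d = - val (AdjoinRoot.root (monicOf r)) d v := by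
  have h : aeval (AdjoinRoot.root (monicOf r)) (monicOf r) = 0 := by
    rw [AdjoinRoot.aeval_eq, AdjoinRoot.mk_self]
  rw [eq_neg_iff_add_eq_zero, ← h, val, Finset.sum_range]
  conv_rhs => arg 2; rw [monicOf]
  simp only [map_add, map_pow, aeval_X, map_sum, map_mul, aeval_C, hv, Algebra.smul_def]

/-- A vector that represents the residue class of `D` modulo `R` vanishes if and only if `R` divides
`D`. -/
theorem forall_eq_zero_iff_monicOf_dvd {d : ℕ} (r : Fin d → K) (v : ℕ → K) (D : K[X])
    (h : val (AdjoinRoot.root (monicOf r)) d v = aeval (AdjoinRoot.root (monicOf r)) D) :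
    (∀ j < d, v (j + 1) = 0) ↔ monicOf r ∣ D := by
  set p : K[X] := ∑ j : Fin d, C (v (j + 1)) * X ^ (j : ℕ) with hp
  have hval : val (AdjoinRoot.root (monicOf r)) d v = aeval (AdjoinRoot.root (monicOf r)) p := by
    rw [hp, val, Finset.sum_range]
    simp [Algebra.smul_def]
  have hsub : monicOf r ∣ D - p := by
    rw [← AdjoinRoot.mk_eq_zero, ← AdjoinRoot.aeval_eq, map_sub, ← h, hval, sub_self]
  have hdeg : p.degree < (monicOf r).degree := by
    rw [degree_eq_natDegree (monicOf_monic r).ne_zero, monicOf_natDegree]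
    exact degree_sum_fin_lt fun j : Fin d => v (j + 1)
  rw [← dvd_iff_dvd_of_dvd_sub (dvd_sub_comm.1 hsub)]
  constructor
  · intro hz
    rw [hp, Finset.sum_eq_zero fun j _ => by rw [hz j j.2, C_0, zero_mul]]
    exact dvd_zero _
  · intro hdvd j hj
    have hp0 : p = 0 := eq_zero_of_dvd_of_degree_lt hdvd hdeg
    have := congrArg (fun q : K[X] => q.coeff j) hp0
    simpa [hp, finsetSum_coeff, coeff_C_mul, coeff_X_pow, Finset.sum_ite_eq,
      Fin.sum_univ_eq_sum_range (fun i => if j = i then v (i + 1) else 0), hj] using this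

theorem resSeq_one {S : Type*} [CommRing S] [Algebra K S] (x π : S) {c : ℕ → K}
    (hc : ∀ i, c i = 0) (i : ℕ) : resSeq x c 1 π i = x ^ i := by
  induction i with
  | zero => simp [resSeq]
  | succ i ih => rw [resSeq, ih, hc, zero_smul, sub_zero, pow_succ']

/-- The recurrence of the program follows the recurrence of `shiftRem`, with the opposite sign. -/
theorem resSeq_aeval_shiftRem {S : Type*} [CommRing S] [Algebra K S] (x : S) (P G : K[X])
    {c : ℕ → K} {n : ℕ} (hc : ∀ i < n, c i = (shiftRem P G i).coeff (P.natDegree - 1)) {i : ℕ}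
    (hi : i ≤ n) : resSeq x c (-aeval x G) (-aeval x P) i = -aeval x (shiftRem P G i) := by
  induction i with
  | zero => rfl
  | succ i ih =>
    rw [resSeq, ih (by omega), hc i (by omega), shiftRem]
    simp only [Algebra.smul_def, map_sub, map_mul, aeval_X, aeval_C]
    ring

end Algebra

/-! ### One trial -/

/-- Store in the field array `a` minus the residue class of the polynomial in the field array
`f`. -/
def residue (a f : ℕ) : Prog :=
  .seq (zeroVec a) <| .seq (oneVec 9) (pass f 13 9 13 a)

/-- Clear the answer if the vector in the field array `10` is not zero. -/
def checkZero : Prog :=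
  .loop 20 (var 5) <|
    .ifField ⟨10, .add (var 20) (.const 1)⟩ .skip (.setInt 2 (.const 0) (.const 0))

/-- Clear the answer if the monic polynomial in the field array `7` does not divide
`(F * G mod P) - H`. -/
def test : Prog :=
  .seq (residue 8 4) <| .seq (residue 12 1) <| .seq (residue 10 2) <|
    .seq (pass 0 6 12 8 10) checkZero

/-- The contents of the memory on which the trials rely: the polynomials `F`, `G`, `H`, `P` in dense
form, the leading coefficients `carry` of the polynomials `X ^ i * G mod P`, the degree `d` of the
test polynomials, and an array of zeros. -/
structure Ready {K : Type u} [Field K] (F G H P : K[X]) (d : ℕ) (s : State K) : Prop where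
  degree : s.int 0 1 = P.natDegree
  dim : s.int 5 0 = d
  left : ∀ i, s.fld 0 i = F.coeff i
  right : ∀ i, s.fld 1 i = G.coeff i
  result : ∀ i, s.fld 2 i = H.coeff i
  modulus : ∀ i, s.fld 4 i = P.coeff i
  carry : ∀ i < P.natDegree, s.fld 6 i = (shiftRem P G i).coeff (P.natDegree - 1)
  zero : ∀ i, s.fld 13 i = 0

variable {K : Type u} [Field K] [Fintype K]

theorem wp_residue {S : Type*} [CommRing S] [Algebra K S] {x : S} {a f : ℕ}
    (ha : a ∉ [f, 13, 7, 9, 11]) (hf : f ∉ [9, 11]) (s : State K) (hd : 0 < s.int 5 0)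
    (hx : x ^ s.int 5 0 = - val x (s.int 5 0) (s.fld 7)) (h13 : ∀ i, s.fld 13 i = 0)
    {A : K[X]} (hA : ∀ i, s.fld f i = A.coeff i) (hdeg : A.natDegree < s.int 0 1 + 1) :
    (residue a f).wp s fun t => val x (s.int 5 0) (t.fld a) = - aeval x A ∧ t.fld a 0 = 0 ∧
      t.ops = s.ops + ((2 * s.int 5 0 + 3) + (s.int 0 1 + 1) * (1 + 6 * s.int 5 0)) := by
  simp only [List.mem_cons, List.not_mem_nil, or_false, not_or] at ha hf
  obtain ⟨haf, ha13, ha7, ha9, ha11⟩ := ha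
  rw [residue, wp_seq]
  refine ((wp_zeroVec_val x a s).and (wp_frame _ s)).mono ?_
  rintro t ⟨⟨t0, tv, tops⟩, ti, tf⟩
  have t5 : t.int 5 = s.int 5 := ti 5 (by simp [zeroVec, Prog.WritesInt])
  have tn : t.int 0 = s.int 0 := ti 0 (by simp [zeroVec, Prog.WritesInt])
  have tF : t.fld f = s.fld f := tf f (by simpa [zeroVec, Prog.WritesFld] using Ne.symm haf)
  have t7 : t.fld 7 = s.fld 7 := tf 7 (by simpa [zeroVec, Prog.WritesFld] using Ne.symm ha7)
  have t13 : t.fld 13 = s.fld 13 := tf 13 (by simpa [zeroVec, Prog.WritesFld] using Ne.symm ha13)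
  rw [wp_seq]
  refine ((wp_oneVec_val x 9 t (by rwa [t5])).and (wp_frame _ t)).mono ?_
  rintro u ⟨⟨u0, uv, uops⟩, ui, uf⟩
  have u5 : u.int 5 = t.int 5 := ui 5 (by simp [oneVec, zeroVec, Prog.WritesInt])
  have un : u.int 0 = t.int 0 := ui 0 (by simp [oneVec, zeroVec, Prog.WritesInt])
  have uF : u.fld f = t.fld f := uf f (by simpa [oneVec, zeroVec, Prog.WritesFld] using hf.1)
  have u7 : u.fld 7 = t.fld 7 := uf 7 (by simp [oneVec, zeroVec, Prog.WritesFld])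
  have u13 : u.fld 13 = t.fld 13 := uf 13 (by simp [oneVec, zeroVec, Prog.WritesFld])
  have ua : u.fld a = t.fld a := uf a (by simpa [oneVec, zeroVec, Prog.WritesFld] using ha9)
  rw [t5] at uv uops
  have e5 : u.int 5 0 = s.int 5 0 := by rw [u5, t5]
  have en : u.int 0 1 = s.int 0 1 := by rw [un, tn]
  refine (wp_pass (x := x) (by simpa [eq_comm, ha9] using Ne.symm hf.1)
    (by simp [haf, ha13, ha7, ha11])
    (by simpa [eq_comm] using hf.2) u (by rw [e5, u7, t7]; exact hx) u0).mono ?_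
  rintro w ⟨w1, w2, w3⟩
  rw [e5, en] at w1 w3
  refine ⟨?_, by rw [w2, ua, t0], by rw [w3, uops, tops]; ring⟩
  rw [w1, ua, tv, uv, zero_sub, uF, tF, aeval_eq_sum_range' hdeg]
  congr 1
  refine Finset.sum_congr rfl fun i _ => ?_
  rw [resSeq_one x _ (fun i => by rw [u13, t13, h13]), hA]

open Classical in
theorem wp_checkZero (s : State K) :
    checkZero.wp s fun t =>
      t.int 2 0 = (if ∀ j < s.int 5 0, s.fld 10 (j + 1) = 0 then s.int 2 0 else 0) ∧
      t.ops = s.ops + s.int 5 0 := by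
  refine wp_loop_frame (fun i t =>
    t.int 2 0 = (if ∀ j < i, s.fld 10 (j + 1) = 0 then s.int 2 0 else 0) ∧ t.ops = s.ops + i)
    (by simp) (fun i hi t ht hti htf => ?_) (fun t ht _ _ => ht)
  have f10 : t.fld 10 = s.fld 10 := htf 10 (by simp [Prog.WritesFld])
  rw [wp_ifField, wp_skip, wp_setInt]
  simp only [FieldRef.get, State.putInt, State.tick, IntExpr.eval, write_apply, and_self, if_true,
    f10, ht.2, add_assoc, and_true, ht.1, Nat.reduceEqDiff, if_false]
  refine ⟨fun h => ?_, fun h => ?_⟩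
  · congr 1
    exact propext ⟨fun h' j hj => (Nat.lt_succ_iff_lt_or_eq.1 hj).elim (h' j) (fun e => e ▸ h),
      fun h' j hj => h' j (hj.trans i.lt_succ_self)⟩
  · rw [if_neg fun h' => h (h' i i.lt_succ_self)]

/-- The number of field operations of `test` when `P` has degree `n`: three times `residue`, once
`pass` and once `checkZero`. -/
def testCost (n d : ℕ) : ℕ := 3 * (2 * d + 3) + 4 * ((n + 1) * (1 + 6 * d)) + d

open Classical in
/-- If the polynomial `R` has been drawn, then `test` keeps the answer if `R` divides
`(F * G mod P) - H`, and otherwise clears it. -/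
theorem wp_test {F G H P : K[X]} {d : ℕ} (hP : P.Monic) (hn : 1 ≤ P.natDegree) (hd : 0 < d)
    (hF : F.degree < P.natDegree) (hG : G.degree < P.natDegree) (hH : H.degree < P.natDegree)
    (s : State K) (hs : Ready F G H P d s) (r : Fin d → K)
    (hr : ∀ i : Fin d, s.fld 7 (i + 1) = r i) :
    test.wp s fun t =>
      t.int 2 0 = (if monicOf r ∣ (F * G).modByMonic P - H then s.int 2 0 else 0) ∧
      t.ops = s.ops + testCost P.natDegree d := by
  obtain ⟨sn, sd, s0, s1, s2, s4, s6, s13⟩ := hs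
  -- the vectors are residue classes in `K[X] / (R)`
  set x := AdjoinRoot.root (monicOf r)
  have hx : x ^ d = - val x d (s.fld 7) := root_monicOf_pow r _ hr
  have hlt : ∀ A : K[X], A.degree < P.natDegree → A.natDegree < P.natDegree + 1 := fun A hA =>
    Nat.lt_succ_of_le (natDegree_le_of_degree_le hA.le)
  have frame : ∀ a f, (a = 8 ∨ a = 12 ∨ a = 10) → ∀ s : State K, (residue a f).wp s fun t =>
      (∀ b, b ∉ [20, 21] → t.int b = s.int b) ∧ (∀ b, b ∉ [a, 9, 11] → t.fld b = s.fld b) := by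
    intro a f ha s t ht
    refine ⟨fun b hb => wp_int_frame _ ?_ s t ht, fun b hb => wp_fld_frame _ ?_ s t ht⟩
    · simp only [List.mem_cons, List.not_mem_nil, or_false, not_or] at hb
      simp [residue, zeroVec, oneVec, pass, passBody, Prog.WritesInt, hb.1, hb.2]
    · simp only [List.mem_cons, List.not_mem_nil, or_false, not_or] at hb
      simp [residue, zeroVec, oneVec, pass, passBody, Prog.WritesFld, hb.1, hb.2.1, hb.2.2]
  -- array `8`: minus `P`; array `12`: minus `G`; array `10`: minus `H`, to which the last pass adds
  -- the product
  rw [test, wp_seq]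
  refine ((wp_residue (x := x) (by simp) (by simp) s (by omega) (by rw [sd]; exact hx) s13 s4
    (by omega)).and (frame 8 4 (by simp) s)).mono ?_
  rintro t ⟨⟨tv, -, tops⟩, ti, tf⟩
  rw [sd] at tv
  rw [sd, sn] at tops
  have t5 : t.int 5 0 = d := by rw [ti 5 (by simp), sd]
  have tn : t.int 0 1 = P.natDegree := by rw [ti 0 (by simp), sn]
  rw [wp_seq]
  refine ((wp_residue (x := x) (A := G) (by simp) (by simp) t (by omega)
    (by rw [t5, tf 7 (by simp)]; exact hx) (by rw [tf 13 (by simp)]; exact s13)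
    (by rw [tf 1 (by simp)]; exact s1) (by rw [tn]; exact hlt G hG)).and
    (frame 12 1 (by simp) t)).mono ?_
  rintro u ⟨⟨uv, u0, uops⟩, ui, uf⟩
  rw [t5] at uv
  rw [t5, tn] at uops
  have u5 : u.int 5 0 = d := by rw [ui 5 (by simp), t5]
  have un : u.int 0 1 = P.natDegree := by rw [ui 0 (by simp), tn]
  rw [wp_seq]
  refine ((wp_residue (x := x) (A := H) (by simp) (by simp) u (by omega)
    (by rw [u5, uf 7 (by simp), tf 7 (by simp)]; exact hx)
    (by rw [uf 13 (by simp), tf 13 (by simp)]; exact s13)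
    (by rw [uf 2 (by simp), tf 2 (by simp)]; exact s2) (by rw [un]; exact hlt H hH)).and
    (frame 10 2 (by simp) u)).mono ?_
  rintro v ⟨⟨vv, -, vops⟩, vi, vf⟩
  rw [u5] at vv
  rw [u5, un] at vops
  have v5 : v.int 5 0 = d := by rw [vi 5 (by simp), u5]
  have vn : v.int 0 1 = P.natDegree := by rw [vi 0 (by simp), un]
  rw [wp_seq]
  refine ((wp_pass (x := x) (f := 0) (c := 6) (γ := 12) (π := 8) (acc := 10) (by simp) (by simp)
    (by simp) v (by rw [v5, vf 7 (by simp), uf 7 (by simp), tf 7 (by simp)]; exact hx)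
    (by rw [vf 12 (by simp)]; exact u0)).and
    ((wp_int_frame (a := 5) _ (by simp [pass, passBody, Prog.WritesInt]) v).and
    (wp_int_frame (a := 2) _ (by simp [pass, passBody, Prog.WritesInt]) v))).mono ?_
  rintro w ⟨⟨wv, -, wops⟩, w5, w2⟩
  rw [v5, vn] at wv wops
  have hval : val x d (w.fld 10) = aeval x ((F * G).modByMonic P - H) := by
    rw [wv, vv, vf 12 (by simp), uv, vf 8 (by simp), uf 8 (by simp), tv,
      ← sum_coeff_mul_shiftRem hP hn hF hG, map_sub, map_sum, sub_eq_add_neg, add_comm,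
      sub_eq_add_neg, ← Finset.sum_neg_distrib]
    congr 1
    refine Finset.sum_congr rfl fun i hi => ?_
    rw [resSeq_aeval_shiftRem (n := P.natDegree) x P G
      (by rw [vf 6 (by simp), uf 6 (by simp), tf 6 (by simp)]; exact s6)
      (Nat.lt_succ_iff.1 (Finset.mem_range.1 hi)), vf 0 (by simp), uf 0 (by simp), tf 0 (by simp),
      s0, smul_neg, neg_neg, map_mul, aeval_C, Algebra.smul_def]
  refine (wp_checkZero w).mono ?_
  rintro z ⟨z2, zops⟩
  have h5 : w.int 5 0 = d := by rw [w5, v5]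
  rw [h5] at z2 zops
  constructor
  · rw [z2, w2, vi 2 (by simp), ui 2 (by simp), ti 2 (by simp)]
    congr 1
    exact propext (forall_eq_zero_iff_monicOf_dvd r _ _ hval)
  · rw [zops, wops, vops, uops, tops, testCost]; ring

end

section

open Polynomial

/-! ### Preparation -/

/-- Write the dense coefficient vector of `P` in the field array `4`. -/
def densify : Prog :=
  .loop 20 (.cell 0 (.const 2)) <|
    .setField ⟨4, .cell 1 (var 20)⟩ (.add ⟨4, .cell 1 (var 20)⟩ ⟨3, var 20⟩)

/-- Write the coefficient vector of `X ^ n * G` in the field array `5`. -/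
def copyShifted : Prog :=
  .loop 20 (.cell 0 (.const 1)) <|
    .setField ⟨5, .add (var 20) (.cell 0 (.const 1))⟩ (.copy ⟨1, var 20⟩)

/-- In round `i`, subtract from the field array `5` the multiple of `X ^ (n - 1 - i) * P` that
clears the coefficient of `X ^ (2 * n - 1 - i)`, and record this coefficient in the field array `6`.
Before round `i` the array holds `X ^ (n - i) * shiftRem P G i`. -/
def divide : Prog :=
  .loop 20 (.cell 0 (.const 1)) <|
    .seq (.setField ⟨6, var 20⟩ (.copy ⟨5, .sub (.sub (.add (.cell 0 (.const 1))
        (.cell 0 (.const 1))) (.const 1)) (var 20)⟩)) <|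
      .loop 21 (.cell 0 (.const 2)) <|
        .seq (.setField ⟨11, .const 0⟩ (.mul ⟨6, var 20⟩ ⟨3, var 21⟩)) <|
          .setField
            ⟨5, .add (.cell 1 (var 21)) (.sub (.sub (.cell 0 (.const 1)) (.const 1)) (var 20))⟩
            (.sub
              ⟨5, .add (.cell 1 (var 21)) (.sub (.sub (.cell 0 (.const 1)) (.const 1)) (var 20))⟩
              ⟨11, .const 0⟩)

/-- Compute in the integer variable `out` the least `k` with `N ≤ b ^ k`, by `N` rounds in which `k`
is increased as long as `b ^ k < N`; the integer variable `17` holds `b ^ k`. -/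
def ceilLog (b N : IntExpr) (out : ℕ) : Prog :=
  .seq (.setInt 17 (.const 0) (.const 1)) <| .seq (.setInt out (.const 0) (.const 0)) <|
    .loop 20 N <| .ifInt (.sub N (var 17)) .skip <|
      .seq (.setInt 17 (.const 0) (.mul (var 17) b))
        (.setInt out (.const 0) (.add (var out) (.const 1)))

/-- The degree of the random polynomials.  Over a large field linear polynomials are good enough. -/
def degreeParam (q n : ℕ) : ℕ := if n * n ≤ q then 1 else 2 * Nat.clog q (8 * n)

/-- The number of trials for an error probability of `1 / N`.  A single trial with a linear
polynomial is exact for `n = 1`, because a nonzero constant has no divisor of degree one. -/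
def trialParam (q n N : ℕ) : ℕ :=
  if n * n ≤ q then (if n ≤ 1 then 1 else 2 * Nat.clog q N) else 3 * Nat.clog 2 N

/-- Compute `degreeParam` in the integer variable `5` and `trialParam` in the integer variable
`6`. -/
def parameters : Prog :=
  .seq (ceilLog (.const 2) (.cell 0 (.const 3)) 14) <|
  .seq (ceilLog (.cell 0 (.const 0)) (.cell 0 (.const 3)) 15) <|
  .seq (ceilLog (.cell 0 (.const 0)) (.mul (.const 8) (.cell 0 (.const 1))) 16) <|
  .ifInt (.sub (.mul (.cell 0 (.const 1)) (.cell 0 (.const 1))) (.cell 0 (.const 0)))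
    (.seq (.setInt 5 (.const 0) (.const 1)) <|
      .ifInt (.sub (.cell 0 (.const 1)) (.const 1)) (.setInt 6 (.const 0) (.const 1))
        (.setInt 6 (.const 0) (.mul (.const 2) (var 15))))
    (.seq (.setInt 5 (.const 0) (.mul (.const 2) (var 16)))
      (.setInt 6 (.const 0) (.mul (.const 3) (var 14))))

/-- Everything that precedes the trials. -/
def prepare : Prog :=
  .seq densify <| .seq copyShifted <| .seq divide <| .seq parameters <|
    .setInt 2 (.const 0) (.const 1)

/-- The part of `P` that consists of its first `l` monomials. -/
noncomputable def partialPoly {K : Type u} [Field K] (P : K[X]) (l : ℕ) : K[X] :=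
  ∑ i ∈ Finset.range l,
    monomial ((exponents P).getD i 0) (((exponents P).map P.coeff).getD i 0)

theorem partialPoly_card {K : Type u} [Field K] (P : K[X]) :
    partialPoly P P.support.card = P := by
  have hlen : (exponents P).length = P.support.card := P.support.length_sort _
  have h : partialPoly P P.support.card =
      ((exponents P).map fun e => monomial e (P.coeff e)).sum := by
    rw [← Fin.sum_univ_getElem, partialPoly, Finset.sum_range]
    refine Fintype.sum_equiv (finCongr (by simp [hlen])) _ _ fun i => ?_
    have hi : (i : ℕ) < (exponents P).length := by rw [hlen]; exact i.2
    simp [hi]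
  rw [h, exponents, ← Multiset.sum_coe, ← Multiset.map_coe, Finset.sort_eq]
  exact (P.as_sum_support).symm

variable {K : Type u} [Field K] [Fintype K]

theorem wp_ceilLog (b N : IntExpr) (out : ℕ) (s : State K) (hout : out ≠ 17) (hout' : out ≠ 20)
    (b' N' : ℕ) (hb : ∀ t : State K, t.int 0 = s.int 0 → b.eval t.int = b')
    (hN : ∀ t : State K, t.int 0 = s.int 0 → N.eval t.int = N') (h0 : out ≠ 0) (hb1 : 1 < b') :
    (ceilLog b N out).wp s fun t => t.int out 0 = Nat.clog b' N' ∧ t.ops = s.ops := by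
  simp only [ceilLog, wp_seq, wp_setInt, IntExpr.eval]
  have hN0 : N.eval ((s.putInt 17 0 1).putInt out 0 0).int = N' := hN _ (by
    simp [State.putInt, write_of_ne, h0.symm])
  refine wp_loop_frame (fun i t => t.int 17 0 = b' ^ t.int out 0 ∧ t.int out 0 ≤ Nat.clog b' N' ∧
    (t.int out 0 = i ∨ N' ≤ t.int 17 0) ∧ t.ops = s.ops) ?_ (fun i hi t ht hti _ => ?_)
    (fun t ht _ _ => ?_)
  · simp [State.putInt, write_apply, hout.symm]
  · obtain ⟨h1, h2, h3, h4⟩ := ht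
    have t0 : (t.putInt 20 0 i).int 0 = s.int 0 := by
      have := hti 0 (by simp [Prog.WritesInt, h0.symm])
      simpa [State.putInt, write_of_ne, h0.symm] using this
    simp only [wp_ifInt, wp_skip, wp_seq, wp_setInt, IntExpr.eval, hN _ t0, hb _ t0]
    have e17 : (t.putInt 20 0 i).int 17 0 = t.int 17 0 := by simp [State.putInt, write_apply]
    have eout : (t.putInt 20 0 i).int out 0 = t.int out 0 := by
      simp [State.putInt, write_apply, hout']
    rw [e17]
    constructor
    · intro h
      rw [eout]
      exact ⟨h1, h2, Or.inr (by omega), h4⟩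
    · intro h
      have e1 : (((t.putInt 20 0 i).putInt 17 0 (t.int 17 0 * b')).putInt out 0
          (((t.putInt 20 0 i).putInt 17 0 (t.int 17 0 * b')).int out 0 + 1)).int out 0 =
          t.int out 0 + 1 := by
        simp [State.putInt, write_apply, hout, hout']
      have e2 : (((t.putInt 20 0 i).putInt 17 0 (t.int 17 0 * b')).putInt out 0
          (((t.putInt 20 0 i).putInt 17 0 (t.int 17 0 * b')).int out 0 + 1)).int 17 0 =
          t.int 17 0 * b' := by
        simp [State.putInt, write_apply, hout.symm]
      rw [e1, e2]
      refine ⟨by rw [h1, pow_succ], ?_, Or.inl (by omega), h4⟩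
      exact (Nat.lt_clog_iff_pow_lt hb1).2 (by omega)
  · rw [hN0] at ht
    obtain ⟨h1, h2, h3, h4⟩ := ht
    refine ⟨le_antisymm h2 ?_, h4⟩
    rw [Nat.clog_le_iff_le_pow hb1]
    rcases h3 with h3 | h3
    · rw [h3]; exact (Nat.lt_pow_self hb1).le
    · rwa [← h1]

theorem wp_parameters (s : State K) (hq : 1 < s.int 0 0) :
    parameters.wp s fun t => t.int 5 0 = degreeParam (s.int 0 0) (s.int 0 1) ∧
      t.int 6 0 = trialParam (s.int 0 0) (s.int 0 1) (s.int 0 3) ∧ t.ops = s.ops := by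
  rw [parameters, wp_seq]
  refine ((wp_ceilLog _ _ 14 s (by simp) (by simp) 2 (s.int 0 3) (fun _ _ => rfl)
    (fun t ht => by simp [IntExpr.eval, ht]) (by simp) (by simp)).and
    (wp_int_frame (a := 0) _ (by simp [ceilLog, Prog.WritesInt]) s)).mono ?_
  rintro t ⟨⟨t14, tops⟩, t0⟩
  rw [wp_seq]
  refine ((wp_ceilLog _ _ 15 t (by simp) (by simp) (s.int 0 0) (s.int 0 3)
    (fun t ht => by simp [IntExpr.eval, ht, t0])
    (fun t ht => by simp [IntExpr.eval, ht, t0]) (by simp) hq).and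
    ((wp_int_frame (a := 0) _ (by simp [ceilLog, Prog.WritesInt]) t).and
    (wp_int_frame (a := 14) _ (by simp [ceilLog, Prog.WritesInt]) t))).mono ?_
  rintro u ⟨⟨u15, uops⟩, u0, u14⟩
  rw [wp_seq]
  refine ((wp_ceilLog _ _ 16 u (by simp) (by simp) (s.int 0 0) (8 * s.int 0 1)
    (fun t ht => by simp [IntExpr.eval, ht, u0, t0])
    (fun t ht => by simp [IntExpr.eval, ht, u0, t0]) (by simp) hq).and
    ((wp_int_frame (a := 0) _ (by simp [ceilLog, Prog.WritesInt]) u).and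
    ((wp_int_frame (a := 14) _ (by simp [ceilLog, Prog.WritesInt]) u).and
    (wp_int_frame (a := 15) _ (by simp [ceilLog, Prog.WritesInt]) u)))).mono ?_
  rintro v ⟨⟨v16, vops⟩, v0, v14, v15⟩
  rw [u0, t0] at v0
  rw [u14] at v14
  simp only [wp_ifInt, wp_seq, wp_setInt, IntExpr.eval, v0]
  refine ⟨fun h => ⟨fun h' => ?_, fun h' => ?_⟩, fun h => ?_⟩
  · have hle : s.int 0 1 * s.int 0 1 ≤ s.int 0 0 := by omega
    simp only [State.putInt, write_of_ne _ (show 0 ≠ 5 by simp), v0] at h'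
    have hle' : s.int 0 1 ≤ 1 := by omega
    simp [State.putInt, write_apply, degreeParam, trialParam, hle, hle', vops, uops, tops]
  · have hle : s.int 0 1 * s.int 0 1 ≤ s.int 0 0 := by omega
    simp only [State.putInt, write_of_ne _ (show 0 ≠ 5 by simp), v0] at h'
    have hle' : ¬ s.int 0 1 ≤ 1 := by omega
    simp [State.putInt, write_apply, degreeParam, trialParam, hle, hle', v15, u15, vops, uops, tops]
  · have hle : ¬ s.int 0 1 * s.int 0 1 ≤ s.int 0 0 := by omega
    simp [State.putInt, write_apply, degreeParam, trialParam, hle, v16, v14, t14, vops, uops, tops]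

/-- The monomials of `P` are in place in the integer array `1` and the field array `3`. -/
structure SparseInput (P : K[X]) (s : State K) : Prop where
  degree : s.int 0 1 = P.natDegree
  card : s.int 0 2 = P.support.card
  exps : ∀ i, s.int 1 i = (exponents P).getD i 0
  coeffs : ∀ i, s.fld 3 i = ((exponents P).map P.coeff).getD i 0

theorem wp_densify {P : K[X]} (s : State K) (hs : SparseInput P s) (h4 : ∀ i, s.fld 4 i = 0) :
    densify.wp s fun t => (∀ i, t.fld 4 i = P.coeff i) ∧ t.ops = s.ops + P.support.card := by
  refine wp_loop_frame (fun l t => (∀ i, t.fld 4 i = (partialPoly P l).coeff i) ∧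
    t.ops = s.ops + l) ?_ (fun l hl t ht hti htf => ?_) (fun t ht _ _ => ?_)
  · simp [partialPoly, h4]
  · have t1 : t.int 1 = s.int 1 := hti 1 (by simp [Prog.WritesInt])
    have t3 : t.fld 3 = s.fld 3 := htf 3 (by simp [Prog.WritesFld])
    rw [wp_setField]
    refine ⟨fun i => ?_, by simp [State.putField, State.putInt, ht.2, add_assoc]⟩
    simp only [State.putField, State.putInt, IntExpr.eval, FieldExpr.eval, FieldRef.get,
      write_apply, and_self, if_true, true_and, t1, t3, hs.exps, hs.coeffs, ht.1, partialPoly,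
      Finset.sum_range_succ, coeff_add, coeff_monomial, OfNat.one_ne_ofNat, false_and, if_false]
    by_cases h : i = (exponents P).getD l 0
    · rw [if_pos h, if_pos h.symm, h]
    · rw [if_neg h, if_neg (Ne.symm h), add_zero]
  · simp only [IntExpr.eval, hs.card, partialPoly_card] at ht
    exact ht

theorem wp_copyShifted {P G : K[X]} (s : State K) (hs : SparseInput P s)
    (hG : G.degree < P.natDegree) (h1 : ∀ i, s.fld 1 i = G.coeff i) (h5 : ∀ i, s.fld 5 i = 0) :
    copyShifted.wp s fun t => (∀ i, t.fld 5 i = (X ^ P.natDegree * G).coeff i) ∧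
      t.ops = s.ops + P.natDegree := by
  set n := P.natDegree with hn
  refine wp_loop_frame (fun l t => (∀ i, t.fld 5 i = if n ≤ i ∧ i < n + l then G.coeff (i - n)
    else 0) ∧ t.ops = s.ops + l) ?_ (fun l hl t ht hti htf => ?_) (fun t ht _ _ => ?_)
  · refine ⟨fun i => ?_, rfl⟩
    rw [h5, if_neg (by omega)]
  · have t0 : t.int 0 = s.int 0 := hti 0 (by simp [Prog.WritesInt])
    have t1 : t.fld 1 = s.fld 1 := htf 1 (by simp [Prog.WritesFld])
    rw [wp_setField]
    refine ⟨fun i => ?_, by simp [State.putField, State.putInt, ht.2, add_assoc]⟩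
    simp only [State.putField, State.putInt, IntExpr.eval, FieldExpr.eval, FieldRef.get,
      write_apply, and_self, if_true, true_and, t0, t1, h1, ht.1, hs.degree, ← hn,
      OfNat.zero_ne_ofNat, false_and, if_false]
    by_cases h : i = l + n
    · rw [if_pos h, if_pos (by omega), h, Nat.add_sub_cancel]
    · rw [if_neg h]
      congr 1
      exact propext ⟨fun h => by omega, fun h => by omega⟩
  · simp only [IntExpr.eval, hs.degree, ← hn] at ht
    refine ⟨fun i => ?_, ht.2⟩
    rw [ht.1, coeff_X_pow_mul']
    by_cases h : n ≤ i
    · by_cases h' : i < n + n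
      · rw [if_pos ⟨h, h'⟩, if_pos h]
      · rw [if_neg (by omega), if_pos h, (degree_lt_iff_coeff_zero G n).1 hG _ (by omega)]
    · rw [if_neg (by omega), if_neg h]

theorem wp_divide {P G : K[X]} (s : State K) (hs : SparseInput P s)
    (h5 : ∀ i, s.fld 5 i = (X ^ P.natDegree * G).coeff i) :
    divide.wp s fun t =>
      (∀ i < P.natDegree, t.fld 6 i = (shiftRem P G i).coeff (P.natDegree - 1)) ∧
      t.ops = s.ops + P.natDegree * (1 + 2 * P.support.card) := by
  set n := P.natDegree with hn
  refine wp_loop_frame (fun l t => (∀ i, t.fld 5 i = (X ^ (n - l) * shiftRem P G l).coeff i) ∧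
    (∀ i < l, t.fld 6 i = (shiftRem P G i).coeff (n - 1)) ∧
    t.ops = s.ops + l * (1 + 2 * P.support.card)) ?_ (fun l hl t ht hti htf => ?_)
    (fun t ht _ _ => ?_)
  · simpa [shiftRem] using h5
  · obtain ⟨a1, a2, a3⟩ := ht
    have t0 : t.int 0 = s.int 0 := hti 0 (by simp [Prog.WritesInt])
    have t1 : t.int 1 = s.int 1 := hti 1 (by simp [Prog.WritesInt])
    have t3 : t.fld 3 = s.fld 3 := htf 3 (by simp [Prog.WritesFld])
    simp only [IntExpr.eval, hs.degree, ← hn] at hl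
    rw [wp_seq, wp_setField]
    set c := (shiftRem P G l).coeff (n - 1) with hc
    have hcl : (X ^ (n - l) * shiftRem P G l).coeff (n + n - 1 - l) = c := by
      rw [show n + n - 1 - l = n - 1 + (n - l) by omega, coeff_X_pow_mul]
    refine wp_loop_frame (fun j u => (∀ i, u.fld 5 i = (X ^ (n - l) * shiftRem P G l).coeff i -
        c * (partialPoly P j * X ^ (n - 1 - l)).coeff i) ∧ u.ops = t.ops + 1 + 2 * j)
      ?_ (fun j hj u hu hui huf => ?_) (fun u hu hui huf => ?_)
    · simp [State.putField, State.putInt, write_apply, a1, partialPoly]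
    · have u0 : u.int 0 = s.int 0 := by
        rw [← t0, hui 0 (by simp [Prog.WritesInt])]
        simp [State.putInt, State.putField, write_of_ne]
      have u1 : u.int 1 = s.int 1 := by
        rw [← t1, hui 1 (by simp [Prog.WritesInt])]
        simp [State.putInt, State.putField, write_of_ne]
      have u20 : u.int 20 0 = l := by
        rw [hui 20 (by simp [Prog.WritesInt])]; simp [State.putInt, State.putField, write_apply]
      have u3 : u.fld 3 = s.fld 3 := by
        rw [← t3, huf 3 (by simp [Prog.WritesFld])]
        simp [State.putInt, State.putField, write_of_ne]
      have u6 : u.fld 6 l = c := by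
        rw [huf 6 (by simp [Prog.WritesFld])]
        simp [State.putInt, State.putField, write_apply, IntExpr.eval, FieldExpr.eval, FieldRef.get,
          t0, hs.degree, ← hn, a1, hcl]
      simp only [wp_seq, wp_setField]
      refine ⟨fun i => ?_, by simp [State.putField, State.putInt, hu.2]; ring⟩
      simp only [State.putField, State.putInt, IntExpr.eval, FieldExpr.eval, FieldRef.get,
      write_apply, and_self, if_true, true_and, u0, u1, u3, u20, u6, hs.degree, ← hn, hs.exps,
        hs.coeffs, hu.1,
        OfNat.one_ne_ofNat, OfNat.zero_ne_ofNat, false_and, if_false, Nat.reduceEqDiff]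
      have hstep : (partialPoly P (j + 1) * X ^ (n - 1 - l)).coeff i =
          (partialPoly P j * X ^ (n - 1 - l)).coeff i +
          if i = (exponents P).getD j 0 + (n - 1 - l) then
            ((exponents P).map P.coeff).getD j 0 else 0 := by
        rw [partialPoly, Finset.sum_range_succ, add_mul, coeff_add, ← partialPoly,
          ← C_mul_X_pow_eq_monomial, mul_assoc, ← pow_add, coeff_C_mul_X_pow]
      rw [hstep]
      by_cases h : i = (exponents P).getD j 0 + (n - 1 - l)
      · rw [if_pos h, if_pos h, ← h]; ring
      · rw [if_neg h, if_neg h, add_zero]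
    · have hT : IntExpr.eval ((t.putInt 20 0 l).putField ⟨6, var 20⟩
          (FieldExpr.eval (t.putInt 20 0 l) (.copy ⟨5, .sub (.sub (.add (.cell 0 (.const 1))
          (.cell 0 (.const 1))) (.const 1)) (var 20)⟩))).int
          (.cell 0 (.const 2)) = P.support.card := by
        simp [State.putInt, State.putField, write_apply, IntExpr.eval, t0, hs.card]
      rw [hT, partialPoly_card] at hu
      refine ⟨fun i => ?_, fun i hi => ?_, by rw [hu.2, a3]; ring⟩
      · rw [hu.1, shiftRem, ← hn, ← hc]
        have : X ^ (n - (l + 1)) * (X * shiftRem P G l - C c * P) =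
            X ^ (n - l) * shiftRem P G l - C c * (P * X ^ (n - 1 - l)) := by
          rw [show n - l = (n - (l + 1)) + 1 by omega, show n - 1 - l = n - (l + 1) by omega]
          ring
        rw [this, coeff_sub, coeff_C_mul]
      · rw [huf 6 (by simp [Prog.WritesFld])]
        by_cases h : i = l
        · subst h
          simp [State.putInt, State.putField, write_apply, IntExpr.eval, FieldExpr.eval,
            FieldRef.get, t0, hs.degree, ← hn, a1, hcl, ← hc]
        · simp [State.putInt, State.putField, write_apply, IntExpr.eval, h, a2 i (by omega)]
  · simp only [IntExpr.eval, hs.degree, ← hn] at ht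
    exact ⟨ht.2.1, ht.2.2⟩

/-- The number of field operations of `prepare`. -/
def prepareCost (n T : ℕ) : ℕ := T + n + n * (1 + 2 * T)

theorem wp_prepare {F G H P : K[X]} {ε : ℝ} (hG : G.degree < P.natDegree) :
    prepare.wp (input F G H P ε) fun t =>
      Ready F G H P (degreeParam (Fintype.card K) P.natDegree) t ∧
      t.int 6 0 = trialParam (Fintype.card K) P.natDegree ⌈1 / ε⌉₊ ∧ t.int 2 0 = 1 ∧
      t.ops = prepareCost P.natDegree P.support.card := by
  set s : State K := input F G H P ε with hs
  have frame : ∀ A : Prog, A = densify ∨ A = copyShifted ∨ A = divide →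
      ∀ s : State K, A.wp s fun t => (∀ b, b ∉ [20, 21] → t.int b = s.int b) ∧
        (∀ b, b ∉ [4, 5, 6, 11] → t.fld b = s.fld b) := by
    intro A hA s t ht
    refine ⟨fun b hb => wp_int_frame _ ?_ s t ht, fun b hb => wp_fld_frame _ ?_ s t ht⟩
    · simp only [List.mem_cons, List.not_mem_nil, or_false, not_or] at hb
      rcases hA with rfl | rfl | rfl <;>
      simp [densify, copyShifted, divide, Prog.WritesInt, hb.1, hb.2]
    · simp only [List.mem_cons, List.not_mem_nil, or_false, not_or] at hb
      rcases hA with rfl | rfl | rfl <;>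
      simp [densify, copyShifted, divide, Prog.WritesFld, hb.1, hb.2.1, hb.2.2.1, hb.2.2.2]
  have sparse : ∀ t : State K, t.int 0 = s.int 0 → t.int 1 = s.int 1 → t.fld 3 = s.fld 3 →
      SparseInput P t := fun t h0 h1 h3 =>
    ⟨by simp [h0, hs, input], by simp [h0, hs, input], by simp [h1, hs, input],
      by simp only [h3, hs, input, implies_true]⟩
  rw [prepare, wp_seq]
  refine ((wp_densify s (sparse s rfl rfl rfl) (fun _ => rfl)).and
    ((frame densify (by simp) s).and
      (wp_fld_frame (a := 5) _ (by simp [densify, Prog.WritesFld]) s))).mono ?_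
  rintro t ⟨⟨t4, tops⟩, ⟨ti, tf⟩, t5⟩
  rw [wp_seq]
  refine ((wp_copyShifted t (sparse t (ti 0 (by simp)) (ti 1 (by simp)) (tf 3 (by simp))) hG
    (fun i => by rw [tf 1 (by simp)]; rfl)
    (fun i => by rw [t5]; rfl)).and
    ((frame copyShifted (by simp) t).and
      (wp_fld_frame (a := 4) _ (by simp [copyShifted, Prog.WritesFld]) t))).mono ?_
  rintro u ⟨⟨u5, uops⟩, ⟨ui, uf⟩, u4⟩
  rw [wp_seq]
  refine ((wp_divide u (sparse u ((ui 0 (by simp)).trans (ti 0 (by simp)))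
    ((ui 1 (by simp)).trans (ti 1 (by simp))) ((uf 3 (by simp)).trans (tf 3 (by simp)))) u5).and
    ((frame divide (by simp) u).and
      (wp_fld_frame (a := 4) _ (by simp [divide, Prog.WritesFld]) u))).mono ?_
  rintro v ⟨⟨v6, vops⟩, ⟨vi, vf⟩, v4⟩
  have v0 : v.int 0 = s.int 0 := (vi 0 (by simp)).trans ((ui 0 (by simp)).trans (ti 0 (by simp)))
  have eq : v.int 0 0 = Fintype.card K := by rw [v0]; rfl
  have en : v.int 0 1 = P.natDegree := by rw [v0]; rfl
  have eN : v.int 0 3 = ⌈1 / ε⌉₊ := by rw [v0]; rfl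
  rw [wp_seq]
  have hfr : parameters.wp v fun w => w.int 0 = v.int 0 ∧ w.fld = v.fld := fun w hw =>
    ⟨wp_int_frame _ (by simp [parameters, ceilLog, Prog.WritesInt]) v w hw,
      funext fun a => wp_fld_frame _ (by simp [parameters, ceilLog, Prog.WritesFld]) v w hw⟩
  refine ((wp_parameters v (by rw [eq]; exact Fintype.one_lt_card)).and hfr).mono ?_
  rintro w ⟨⟨w5, w6, wops⟩, w0, wf⟩
  rw [eq, en] at w5
  rw [eq, en, eN] at w6
  rw [wp_setInt]
  have fl : ∀ b, b ∉ [4, 5, 6, 11] → w.fld b = s.fld b := fun b hb => by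
    rw [wf, vf b hb, uf b hb, tf b hb]
  refine ⟨⟨?_, ?_, fun i => ?_, fun i => ?_, fun i => ?_, fun i => ?_, fun i hi => ?_, fun i => ?_⟩,
    ?_, ?_, ?_⟩
  · simp [State.putInt, write_apply, w0, en]
  · simp [State.putInt, write_apply, w5]
  · simp only [State.putInt, fl 0 (by simp)]; rfl
  · simp only [State.putInt, fl 1 (by simp)]; rfl
  · simp only [State.putInt, fl 2 (by simp)]; rfl
  · simp only [State.putInt, wf, v4, u4, t4]
  · simp only [State.putInt, wf, v6 i hi]
  · simp only [State.putInt, fl 13 (by simp)]; rfl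
  · simp [State.putInt, write_apply, w6]
  · simp [State.putInt, write_apply, IntExpr.eval]
  · simp only [State.putInt, wops, vops, uops, tops, prepareCost]
    simp [hs, input]

end

section

open Polynomial

/-! ### Random polynomials that do not divide a given polynomial -/

variable {K : Type u} [Field K] [Fintype K]

theorem pow_card_pow_natDegree_minpoly {L : Type*} [Field L] [Finite L] [Algebra K L] (α : L) :
    α ^ Fintype.card K ^ (minpoly K α).natDegree = α := by
  have : Module.Finite K L := Module.Finite.of_finite
  have hα : IsIntegral K α := IsIntegral.of_finite K α
  let E := IntermediateField.adjoin K {α}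
  have : Fintype E := Fintype.ofFinite E
  have hcard : Fintype.card E = Fintype.card K ^ (minpoly K α).natDegree := by
    rw [← IntermediateField.adjoin.finrank hα, Module.card_eq_pow_finrank (K := K)]
  have h := FiniteField.pow_card (⟨α, IntermediateField.mem_adjoin_simple_self K α⟩ : E)
  rw [hcard] at h
  exact congrArg Subtype.val h

theorem sum_Icc_pow_le {q : ℕ} (hq : 2 ≤ q) (h : ℕ) : ∑ e ∈ Finset.Icc 1 h, q ^ e ≤ 2 * q ^ h := by
  induction h with
  | zero => simp
  | succ h ih =>
    rw [Finset.sum_Icc_succ_top (by omega), pow_succ]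
    nlinarith [Nat.zero_le (q ^ h)]

open Classical in
/-- There are about `q ^ j / j` monic irreducible polynomials of degree `j` that do not divide a
given polynomial `D` of small degree: they are the minimal polynomials of the elements of degree `j`
of the extension of degree `j` that are not roots of `D`. -/
theorem exists_irreducible_not_dvd_of_finrank (L : Type*) [Field L] [Fintype L] [Algebra K L]
    {D : K[X]} (hD : D ≠ 0) {j : ℕ} (hj : 0 < j) (hrank : Module.finrank K L = j) :
    ∃ S : Finset K[X], (∀ g ∈ S, g.Monic ∧ Irreducible g ∧ g.natDegree = j ∧ ¬ g ∣ D) ∧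
      Fintype.card K ^ j ≤ j * S.card + 2 * Fintype.card K ^ (j / 2) + D.natDegree := by
  have : Module.Finite K L := Module.Finite.of_finite
  have hL : Fintype.card L = Fintype.card K ^ j := by
    rw [Module.card_eq_pow_finrank (K := K), hrank]
  have hq : 2 ≤ Fintype.card K := Fintype.one_lt_card
  let good : Finset L :=
    Finset.univ.filter fun α => (minpoly K α).natDegree = j ∧ aeval α D ≠ 0
  have hint : ∀ α : L, IsIntegral K α := fun α => IsIntegral.of_finite K α
  refine ⟨good.image (minpoly K), ?_, ?_⟩
  · intro g hg
    obtain ⟨α, hα, rfl⟩ := Finset.mem_image.1 hg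
    obtain ⟨h1, h2⟩ := (Finset.mem_filter.1 hα).2
    exact ⟨minpoly.monic (hint α), minpoly.irreducible (hint α), h1,
      fun h => h2 ((minpoly.dvd_iff).1 h)⟩
  · have hgood : good.card ≤ j * (good.image (minpoly K)).card := by
      refine Finset.card_le_mul_card_image good j fun g hg => ?_
      obtain ⟨β, hβ, rfl⟩ := Finset.mem_image.1 hg
      have hβ' := (Finset.mem_filter.1 hβ).2.1
      have hne : minpoly K β ≠ 0 := minpoly.ne_zero (hint β)
      calc _ ≤ ((minpoly K β).aroots L).toFinset.card := by
            refine Finset.card_le_card fun α hα => ?_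
            rw [Multiset.mem_toFinset, mem_aroots]
            refine ⟨hne, ?_⟩
            rw [← (Finset.mem_filter.1 hα).2]
            exact minpoly.aeval K α
        _ ≤ ((minpoly K β).aroots L).card := Multiset.toFinset_card_le _
        _ ≤ _ := (card_roots' _).trans (natDegree_map_le)
        _ = j := hβ'
    -- an element of degree `e < j` satisfies `α ^ q ^ e = α`, and `e ≤ j / 2` as `e` divides `j`
    have hcover : (Finset.univ : Finset L) ⊆ good ∪ (Finset.Icc 1 (j / 2)).biUnion (fun e =>
        ((X ^ Fintype.card K ^ e - X : L[X]).roots).toFinset) ∪ (D.aroots L).toFinset := by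
      intro α _
      by_cases h1 : aeval α D = 0
      · refine Finset.mem_union_right _ ?_
        rw [Multiset.mem_toFinset, mem_aroots]
        exact ⟨hD, h1⟩
      refine Finset.mem_union_left _ ?_
      by_cases h2 : (minpoly K α).natDegree = j
      · exact Finset.mem_union_left _ (Finset.mem_filter.2 ⟨Finset.mem_univ _, h2, h1⟩)
      refine Finset.mem_union_right _ ?_
      have hpos := minpoly.natDegree_pos (hint α)
      obtain ⟨k, hk⟩ : (minpoly K α).natDegree ∣ j := hrank ▸ minpoly.degree_dvd (hint α)
      have hk2 : 2 ≤ k := by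
        rcases k with _ | _ | k
        · omega
        · exact absurd (by rw [hk]; simp) h2
        · omega
      have hle : (minpoly K α).natDegree ≤ j / 2 := by
        rw [Nat.le_div_iff_mul_le (by omega)]
        calc _ ≤ (minpoly K α).natDegree * k := Nat.mul_le_mul_left _ hk2
          _ = j := hk.symm
      rw [Finset.mem_biUnion]
      refine ⟨_, Finset.mem_Icc.2 ⟨hpos, hle⟩, ?_⟩
      rw [Multiset.mem_toFinset, mem_roots
        (FiniteField.X_pow_card_pow_sub_X_ne_zero L hpos.ne' hq)]
      simp [pow_card_pow_natDegree_minpoly]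
    have h1 : ((D.aroots L).toFinset).card ≤ D.natDegree :=
      (Multiset.toFinset_card_le _).trans ((card_roots' _).trans natDegree_map_le)
    have h2 : ((Finset.Icc 1 (j / 2)).biUnion (fun e =>
        ((X ^ Fintype.card K ^ e - X : L[X]).roots).toFinset)).card ≤
        2 * Fintype.card K ^ (j / 2) := by
      refine Finset.card_biUnion_le.trans ((Finset.sum_le_sum fun e he => ?_).trans
        (sum_Icc_pow_le hq _))
      refine (Multiset.toFinset_card_le _).trans ((card_roots' _).trans ?_)
      rw [FiniteField.X_pow_card_pow_sub_X_natDegree_eq L (by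
        have := (Finset.mem_Icc.1 he).1; omega) hq]
    calc Fintype.card K ^ j = (Finset.univ : Finset L).card := by rw [Finset.card_univ, hL]
      _ ≤ _ := Finset.card_le_card hcover
      _ ≤ _ := Finset.card_union_le _ _
      _ ≤ _ := add_le_add (Finset.card_union_le _ _) h1
      _ ≤ _ := by gcongr

theorem exists_irreducible_not_dvd {D : K[X]} (hD : D ≠ 0) {j : ℕ} (hj : 0 < j) :
    ∃ S : Finset K[X], (∀ g ∈ S, g.Monic ∧ Irreducible g ∧ g.natDegree = j ∧ ¬ g ∣ D) ∧
      Fintype.card K ^ j ≤ j * S.card + 2 * Fintype.card K ^ (j / 2) + D.natDegree := by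
  obtain ⟨p, hp⟩ := CharP.exists K
  have : Fact p.Prime := ⟨CharP.char_is_prime K p⟩
  have : NeZero j := ⟨hj.ne'⟩
  have : Fintype (FiniteField.Extension K p j) := Fintype.ofFinite _
  exact exists_irreducible_not_dvd_of_finrank (FiniteField.Extension K p j) hD hj
    (FiniteField.finrank_extension K p j)

open Classical in
theorem card_pow_le_card_multiples {g : K[X]} (hg : g.Monic) {d : ℕ} (hd : g.natDegree ≤ d) :
    Fintype.card K ^ (d - g.natDegree) ≤
      (Finset.univ.filter fun r : Fin d → K => g ∣ monicOf r).card := by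
  have hdeg : ∀ h : Fin (d - g.natDegree) → K, (g * monicOf h).natDegree = d := fun h => by
    rw [hg.natDegree_mul (monicOf_monic h), monicOf_natDegree]; omega
  have hm : ∀ h : Fin (d - g.natDegree) → K,
      monicOf (fun i : Fin d => (g * monicOf h).coeff i) = g * monicOf h := fun h =>
    monicOf_coeff_eq (hg.mul (monicOf_monic h)) (hdeg h)
  calc _ = (Finset.univ : Finset (Fin (d - g.natDegree) → K)).card := by simp
    _ ≤ _ := by
      refine Finset.card_le_card_of_injOn (fun h i => (g * monicOf h).coeff i) (fun h _ => ?_)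
        (fun h _ h' _ hh => ?_)
      · simp [hm]
      · have := congrArg monicOf hh
        rw [hm, hm] at this
        exact monicOf_injective _ (mul_left_cancel₀ hg.ne_zero this)

open Classical in
/-- A positive proportion of the monic polynomials of degree `2 * m` do not divide a polynomial `D`
of degree at most `n`, where `8 * n ≤ q ^ m`: already those with an irreducible factor of degree
greater than `m` that does not divide `D` are a quarter of all. -/
theorem card_pow_le_card_not_dvd {D : K[X]} (hD : D ≠ 0) {n m : ℕ} (hn : 2 ≤ n)
    (hDn : D.natDegree ≤ n) (hm : 8 * n ≤ Fintype.card K ^ m) :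
    Fintype.card K ^ (2 * m) ≤
      4 * (Finset.univ.filter fun r : Fin (2 * m) → K => ¬ monicOf r ∣ D).card := by
  set q := Fintype.card K with hq
  have hq2 : 2 ≤ q := Fintype.one_lt_card
  have hm0 : 0 < m := Nat.pos_of_ne_zero fun h => by
    rw [h, pow_zero] at hm; omega
  have hex : ∀ j : ℕ, ∃ S : Finset K[X], 0 < j →
      (∀ g ∈ S, g.Monic ∧ Irreducible g ∧ g.natDegree = j ∧ ¬ g ∣ D) ∧
      q ^ j ≤ j * S.card + 2 * q ^ (j / 2) + D.natDegree := fun j => by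
    by_cases hj : 0 < j
    · obtain ⟨S, hS⟩ := exists_irreducible_not_dvd hD hj
      exact ⟨S, fun _ => hS⟩
    · exact ⟨∅, fun h => absurd h hj⟩
  choose S hS using hex
  set J := Finset.Ioc m (2 * m) with hJ
  have hJpos : ∀ j ∈ J, 0 < j := fun j hj => by
    have := (Finset.mem_Ioc.1 hj).1; omega
  set N := Finset.univ.filter fun r : Fin (2 * m) → K => ¬ monicOf r ∣ D with hN
  set M : K[X] → Finset (Fin (2 * m) → K) := fun g =>
    Finset.univ.filter fun r : Fin (2 * m) → K => g ∣ monicOf r with hM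
  have hmem : ∀ g ∈ J.biUnion S, g.Monic ∧ Irreducible g ∧ m < g.natDegree ∧
      g.natDegree ≤ 2 * m ∧ ¬ g ∣ D := fun g hg => by
    obtain ⟨j, hj, hg⟩ := Finset.mem_biUnion.1 hg
    obtain ⟨h1, h2, h3, h4⟩ := (hS j (hJpos j hj)).1 g hg
    have := Finset.mem_Ioc.1 hj
    exact ⟨h1, h2, by omega, by omega, h4⟩
  have hsub : (J.biUnion S).biUnion M ⊆ N := fun r hr => by
    obtain ⟨g, hg, hr⟩ := Finset.mem_biUnion.1 hr
    exact Finset.mem_filter.2 ⟨Finset.mem_univ _,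
      fun h => (hmem g hg).2.2.2.2 ((Finset.mem_filter.1 hr).2.trans h)⟩
  -- two different irreducible factors of degree greater than `m` do not fit into degree `2 * m`
  have hdisj : ∀ g ∈ J.biUnion S, ∀ g' ∈ J.biUnion S, g ≠ g' → Disjoint (M g) (M g') := by
    intro g hg g' hg' hne
    rw [Finset.disjoint_left]
    intro r hr hr'
    obtain ⟨a1, a2, a3, a4, -⟩ := hmem g hg
    obtain ⟨b1, b2, b3, b4, -⟩ := hmem g' hg'
    have hcop : IsCoprime g g' := by
      rw [a2.coprime_iff_not_dvd]
      exact fun h => hne (eq_of_monic_of_associated a1 b1 (a2.associated_of_dvd b2 h))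
    have hdvd := hcop.mul_dvd (Finset.mem_filter.1 hr).2 (Finset.mem_filter.1 hr').2
    have := natDegree_le_of_dvd hdvd (monicOf_monic r).ne_zero
    rw [a1.natDegree_mul b1, monicOf_natDegree] at this
    omega
  have hdisjS : ∀ j ∈ J, ∀ j' ∈ J, j ≠ j' → Disjoint (S j) (S j') := by
    intro j hj j' hj' hne
    rw [Finset.disjoint_left]
    intro g hg hg'
    exact hne (((hS j (hJpos j hj)).1 g hg).2.2.1.symm.trans
      ((hS j' (hJpos j' hj')).1 g hg').2.2.1)
  have hsum : ∑ j ∈ J, (S j).card * q ^ (2 * m - j) ≤ N.card := by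
    refine le_trans ?_ (Finset.card_le_card hsub)
    rw [Finset.card_biUnion hdisj, Finset.sum_biUnion hdisjS]
    refine Finset.sum_le_sum fun j hj => ?_
    rw [← smul_eq_mul]
    refine Finset.card_nsmul_le_sum _ _ _ fun g hg => ?_
    obtain ⟨h1, h2, h3, h4⟩ := (hS j (hJpos j hj)).1 g hg
    have := card_pow_le_card_multiples h1 (d := 2 * m) (by
      rw [h3]; exact (Finset.mem_Ioc.1 hj).2)
    rwa [h3] at this
  have hterm : ∀ j ∈ J, q ^ (2 * m) ≤ 4 * m * ((S j).card * q ^ (2 * m - j)) := by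
    intro j hj
    obtain ⟨hmj, hj2⟩ := Finset.mem_Ioc.1 hj
    have hcount := (hS j (hJpos j hj)).2
    -- half of the elements of the extension of degree `j` are of degree `j` and no roots of `D`
    have hhalf : q ^ j ≤ 2 * (j * (S j).card) := by
      have hAB : q ^ (j / 2) * q ^ (j - j / 2) = q ^ j := by
        rw [← pow_add]; congr 1; omega
      have hle : q ^ (j / 2) ≤ q ^ (j - j / 2) := Nat.pow_le_pow_right (by omega) (by omega)
      have hqj : 16 * n ≤ q ^ j := by
        calc 16 * n ≤ q ^ m * q := by nlinarith
          _ = q ^ (m + 1) := (pow_succ q m).symm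
          _ ≤ q ^ j := Nat.pow_le_pow_right (by omega) hmj
      have hB : 6 ≤ q ^ (j - j / 2) := by
        by_contra hlt
        have h5 : q ^ (j - j / 2) ≤ 5 := by omega
        have : q ^ j ≤ 5 * 5 := by
          rw [← hAB]; exact Nat.mul_le_mul (hle.trans h5) h5
        omega
      have h6 : 6 * q ^ (j / 2) ≤ q ^ j := by
        rw [← hAB, mul_comm]; exact Nat.mul_le_mul_left _ hB
      omega
    calc q ^ (2 * m) = q ^ j * q ^ (2 * m - j) := by rw [← pow_add]; congr 1; omega
      _ ≤ (4 * m * (S j).card) * q ^ (2 * m - j) := by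
        refine Nat.mul_le_mul_right _ (hhalf.trans ?_)
        calc 2 * (j * (S j).card) ≤ 2 * (2 * m * (S j).card) := by gcongr
          _ = 4 * m * (S j).card := by ring
      _ = _ := by ring
  have hall : m * q ^ (2 * m) ≤ m * (4 * N.card) := by
    calc m * q ^ (2 * m) = ∑ _j ∈ J, q ^ (2 * m) := by
          rw [Finset.sum_const, hJ, Nat.card_Ioc, smul_eq_mul]; congr 1; omega
      _ ≤ ∑ j ∈ J, 4 * m * ((S j).card * q ^ (2 * m - j)) := Finset.sum_le_sum hterm
      _ = 4 * m * ∑ j ∈ J, (S j).card * q ^ (2 * m - j) := by rw [Finset.mul_sum]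
      _ ≤ 4 * m * N.card := Nat.mul_le_mul_left _ hsum
      _ = m * (4 * N.card) := by ring
  exact Nat.le_of_mul_le_mul_left hall hm0

open Classical in
/-- The monic linear divisors of `D` correspond to roots of `D`. -/
theorem card_linear_dvd_le {D : K[X]} (hD : D ≠ 0) :
    (Finset.univ.filter fun r : Fin 1 → K => monicOf r ∣ D).card ≤ D.natDegree := by
  calc _ ≤ D.roots.toFinset.card := by
        refine Finset.card_le_card_of_injOn (fun r => - r 0) (fun r hr => ?_)
          (fun r _ r' _ h => ?_)
        · have hdvd : monicOf r ∣ D := (Finset.mem_filter.1 hr).2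
          rw [Finset.mem_coe, Multiset.mem_toFinset, mem_roots hD]
          refine IsRoot.dvd ?_ hdvd
          simp [monicOf]
        · funext i
          rw [Subsingleton.elim i 0]
          exact neg_injective h
    _ ≤ _ := (Multiset.toFinset_card_le _).trans (card_roots' _)

end

section

open Polynomial
open scoped ENNReal

/-! ### The verification program -/

/-- Draw a random monic polynomial and use it as a test divisor. -/
def trial : Prog := .seq (drawVec 20 7 (var 5)) test

/-- The verification program: the answer is true if no trial finds a difference. -/
def verifier : Prog := .seq prepare (.loop 22 (var 6) trial)

theorem Ready.of_eq {K : Type u} [Field K] {F G H P : K[X]} {d : ℕ} {s t : State K}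
    (hs : Ready F G H P d s) (h0 : t.int 0 = s.int 0) (h5 : t.int 5 = s.int 5)
    (hf : ∀ b ∈ [0, 1, 2, 4, 6, 13], t.fld b = s.fld b) : Ready F G H P d t := by
  obtain ⟨a1, a2, a3, a4, a5, a6, a7, a8⟩ := hs
  exact ⟨by rw [h0, a1], by rw [h5, a2], by rwa [hf 0 (by simp)], by rwa [hf 1 (by simp)],
    by rwa [hf 2 (by simp)], by rwa [hf 4 (by simp)], by rwa [hf 6 (by simp)],
    by rwa [hf 13 (by simp)]⟩

theorem Ready.drawState {K : Type u} [Field K] {F G H P : K[X]} {d : ℕ} {s : State K}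
    (hs : Ready F G H P d s) (k : ℕ) (r : Fin k → K) : Ready F G H P d (drawState 20 7 k r s) := by
  refine hs.of_eq (drawState_int (by simp) k r s) (drawState_int (by simp) k r s) fun b hb => ?_
  refine drawState_fld_of_ne ?_ k r s
  rintro rfl
  simp at hb

variable {K : Type u} [Field K] [Fintype K]

theorem wp_drawVec (c a : ℕ) (e : IntExpr) (s : State K) (Q : State K → Prop) :
    (drawVec c a e).wp s Q ↔ ∀ r, Q (drawState c a (e.eval s.int) r s) := by
  simp [Prog.wp, drawVec_run]

/-- A trial keeps the memory in order, never sets the answer, and keeps it if the result is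
correct. -/
theorem wp_trial {F G H P : K[X]} {d : ℕ} (hP : P.Monic) (hn : 1 ≤ P.natDegree) (hd : 0 < d)
    (hF : F.degree < P.natDegree) (hG : G.degree < P.natDegree) (hH : H.degree < P.natDegree)
    (s : State K) (hs : Ready F G H P d s) :
    trial.wp s fun t => Ready F G H P d t ∧ t.ops = s.ops + (d + testCost P.natDegree d) ∧
      (s.int 2 0 ≠ 1 → t.int 2 0 ≠ 1) ∧
      (H = (F * G).modByMonic P → t.int 2 0 = s.int 2 0) := by
  have hready : trial.wp s fun t => Ready F G H P d t := fun t ht => by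
    refine hs.of_eq (wp_int_frame _ ?_ s t ht) (wp_int_frame _ ?_ s t ht)
      fun b hb => wp_fld_frame _ ?_ s t ht
    · simp [trial, drawVec, test, residue, checkZero, zeroVec, oneVec, pass, passBody,
        Prog.WritesInt]
    · simp [trial, drawVec, test, residue, checkZero, zeroVec, oneVec, pass, passBody,
        Prog.WritesInt]
    · fin_cases hb <;> simp [trial, drawVec, test, residue, checkZero, zeroVec, oneVec, pass,
        passBody, Prog.WritesFld]
  refine hready.and ?_
  rw [trial, wp_seq, wp_drawVec]
  obtain rfl := hs.dim
  intro r
  refine (wp_test hP hn hd hF hG hH _ (hs.drawState _ r) r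
    fun i => drawState_fld _ _ _ r s i).mono ?_
  rintro t ⟨t2, tops⟩
  have e2 : (FieldRAM.drawState 20 7 (IntExpr.eval s.int (var 5)) r s).int 2 = s.int 2 :=
    drawState_int (by simp) _ r s
  rw [e2] at t2
  refine ⟨?_, fun h => ?_, fun h => ?_⟩
  · rw [tops, drawState_ops, IntExpr.eval, add_assoc]; rfl
  · rw [t2]; split_ifs
    · exact h
    · exact zero_ne_one
  · rw [t2, if_pos (by rw [h, sub_self]; exact dvd_zero _)]

open Classical in
/-- The proportion of the monic polynomials of degree `d` that divide `D`. -/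
noncomputable def divisorRatio (D : K[X]) (d : ℕ) : ℝ :=
  ((Finset.univ.filter fun r : Fin d → K => monicOf r ∣ D).card : ℝ) / (Fintype.card K : ℝ) ^ d

/-- A trial that ends with the answer true has drawn a divisor of `(F * G mod P) - H`. -/
theorem prob_trial_le {F G H P : K[X]} {d : ℕ} (hP : P.Monic) (hn : 1 ≤ P.natDegree) (hd : 0 < d)
    (hF : F.degree < P.natDegree) (hG : G.degree < P.natDegree) (hH : H.degree < P.natDegree)
    (s : State K) (hs : Ready F G H P d s) :
    trial.prob s {t | t.int 2 0 = 1} ≤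
      ENNReal.ofReal (divisorRatio ((F * G).modByMonic P - H) d) := by
  classical
  obtain rfl := hs.dim
  refine (prob_drawVec_seq_le 20 7 (var 5) test s _
    (Finset.univ.filter fun r => monicOf r ∣ (F * G).modByMonic P - H) fun r hr => ?_).trans ?_
  · refine (wp_test hP hn hd hF hG hH _ (hs.drawState _ r) r
      fun i => drawState_fld _ _ _ r s i).mono ?_
    rintro t ⟨t2, -⟩
    have h0 : t.int 2 0 = 0 :=
      t2.trans (if_neg fun h => hr (Finset.mem_filter.2 ⟨Finset.mem_univ _, h⟩))
    simp [h0]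
  · rw [divisorRatio, ENNReal.ofReal_div_of_pos (by positivity), ENNReal.ofReal_pow (by positivity),
      ENNReal.ofReal_natCast, ENNReal.ofReal_natCast]
    rfl

theorem answer_true_eq (A : Prog) (s : State K) :
    A.answer s true = A.prob s {t | t.int 2 0 = 1} := by
  rw [Prog.answer, ← PMF.toOuterMeasure_apply_singleton, PMF.toOuterMeasure_map_apply, Prog.prob]
  congr 1
  ext t
  simp

/-! ### Choice of the parameters -/

theorem degreeParam_pos {q n : ℕ} (hq : 1 < q) (hn : 1 ≤ n) : 0 < degreeParam q n := by
  rw [degreeParam]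
  split_ifs
  · exact one_pos
  · have := Nat.clog_pos hq (show 1 < 8 * n by omega)
    omega

theorem natCast_clog_le {b x : ℕ} (hb : 1 < b) (hx : 1 ≤ x) :
    (Nat.clog b x : ℝ) ≤ 1 + Real.logb b x := by
  rw [← Real.natCeil_logb_natCast, add_comm]
  refine (Nat.ceil_lt_add_one (Real.logb_nonneg ?_ ?_)).le
  · exact_mod_cast hb
  · exact_mod_cast hx

theorem inv_ceil_le {ε : ℝ} (hε : 0 < ε) : ((⌈1 / ε⌉₊ : ℕ) : ℝ)⁻¹ ≤ ε := by
  rw [inv_le_comm₀ (by simpa using hε) hε, ← one_div]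
  exact Nat.le_ceil _

/-- The parameters make the error probability of all trials together at most `ε`. -/
theorem divisorRatio_pow_le {D : K[X]} (hD : D ≠ 0) {n : ℕ} (hn : D.natDegree < n) {ε : ℝ}
    (hε : 0 < ε) :
    divisorRatio D (degreeParam (Fintype.card K) n) ^
      trialParam (Fintype.card K) n ⌈1 / ε⌉₊ ≤ ε := by
  classical
  set q := Fintype.card K with hq
  set N := ⌈1 / ε⌉₊ with hN
  have hq1 : 1 < q := Fintype.one_lt_card
  have hq0 : (0 : ℝ) < q := by exact_mod_cast hq1.le
  have hN0 : 0 < N := Nat.ceil_pos.2 (by positivity)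
  have hNε : (N : ℝ)⁻¹ ≤ ε := inv_ceil_le hε
  have hnn : ∀ d, 0 ≤ divisorRatio D d := fun d => by rw [divisorRatio]; positivity
  by_cases hle : n * n ≤ q
  · have hlin : divisorRatio D 1 ≤ D.natDegree / q := by
      rw [divisorRatio, pow_one]
      gcongr
      exact card_linear_dvd_le hD
    rw [degreeParam, if_pos hle, trialParam, if_pos hle]
    split_ifs with h1
    · rw [show D.natDegree = 0 by omega, Nat.cast_zero, zero_div] at hlin
      rw [pow_one]
      exact hlin.trans hε.le
    · have hsq : divisorRatio D 1 ^ 2 ≤ (q : ℝ)⁻¹ := by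
        calc divisorRatio D 1 ^ 2 ≤ ((D.natDegree : ℝ) / q) ^ 2 := by gcongr; exact hnn 1
          _ ≤ ((n : ℝ) / q) ^ 2 := by gcongr
          _ = ((n * n : ℕ) : ℝ) / q * (q : ℝ)⁻¹ := by push_cast; field_simp
          _ ≤ 1 * (q : ℝ)⁻¹ := by
            gcongr
            rw [div_le_one hq0]
            exact_mod_cast hle
          _ = _ := one_mul _
      calc divisorRatio D 1 ^ (2 * Nat.clog q N) = (divisorRatio D 1 ^ 2) ^ Nat.clog q N :=
            pow_mul _ _ _
        _ ≤ ((q : ℝ)⁻¹) ^ Nat.clog q N := by gcongr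
        _ = ((q ^ Nat.clog q N : ℕ) : ℝ)⁻¹ := by push_cast; rw [inv_pow]
        _ ≤ (N : ℝ)⁻¹ := by
          gcongr
          exact Nat.le_pow_clog hq1 N
        _ ≤ ε := hNε
  · rw [degreeParam, if_neg hle, trialParam, if_neg hle]
    have hn2 : 2 ≤ n := by
      by_contra h
      have : n * n ≤ 1 * 1 := Nat.mul_le_mul (by omega) (by omega)
      omega
    set m := Nat.clog q (8 * n) with hm
    have hcount := card_pow_le_card_not_dvd hD hn2 hn.le (Nat.le_pow_clog hq1 (8 * n))
    have hratio : divisorRatio D (2 * m) ≤ 3 / 4 := by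
      have hsplit := Finset.card_filter_add_card_filter_not
        (s := (Finset.univ : Finset (Fin (2 * m) → K))) (fun r => monicOf r ∣ D)
      rw [Finset.card_univ, Fintype.card_fun, Fintype.card_fin, ← hq] at hsplit
      rw [divisorRatio, div_le_div_iff₀ (by positivity) (by norm_num)]
      rw [← hm, ← hq] at hcount
      have : (Finset.univ.filter fun r : Fin (2 * m) → K => monicOf r ∣ D).card * 4 ≤
          3 * q ^ (2 * m) := by omega
      exact_mod_cast this
    calc divisorRatio D (2 * m) ^ (3 * Nat.clog 2 N) ≤ (3 / 4) ^ (3 * Nat.clog 2 N) := by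
          gcongr; exact hnn _
      _ = ((3 / 4 : ℝ) ^ 3) ^ Nat.clog 2 N := pow_mul _ _ _
      _ ≤ (1 / 2 : ℝ) ^ Nat.clog 2 N := by gcongr; norm_num
      _ = ((2 ^ Nat.clog 2 N : ℕ) : ℝ)⁻¹ := by push_cast; rw [one_div, inv_pow]
      _ ≤ (N : ℝ)⁻¹ := by
        gcongr
        exact Nat.le_pow_clog (by norm_num) N
      _ ≤ ε := hNε

/-- The number of trials times the degree of the test polynomials is within the budget. -/
theorem trialParam_mul_degreeParam_le {q n T : ℕ} (hq : 1 < q) (hn : 1 ≤ n) (hT : 1 ≤ T) {ε : ℝ}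
    (hε : 0 < ε) (hε1 : ε < 1) :
    (trialParam q n ⌈1 / ε⌉₊ : ℝ) * degreeParam q n ≤
      2 * T + 108 * (Real.logb q n * max 1 (Real.logb 2 (1 / ε))) := by
  set N := ⌈1 / ε⌉₊ with hN
  set M := max 1 (Real.logb 2 (1 / ε)) with hM
  set l := Real.logb q n with hl
  have hq' : (1 : ℝ) < q := by exact_mod_cast hq
  have hn' : (1 : ℝ) ≤ n := by exact_mod_cast hn
  have hT' : (1 : ℝ) ≤ T := by exact_mod_cast hT
  have hM1 : 1 ≤ M := le_max_left _ _
  have hl0 : 0 ≤ l := Real.logb_nonneg hq' hn'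
  have hN1 : 1 ≤ N := Nat.ceil_pos.2 (by positivity)
  have hN' : (0 : ℝ) < N := by exact_mod_cast hN1
  have hε' : 1 < 1 / ε := by rw [lt_div_iff₀ hε]; linarith
  have hlogN : Real.logb 2 N ≤ 2 * M := by
    have h1 : (N : ℝ) ≤ 2 * (1 / ε) := by
      have := (Nat.ceil_lt_add_one (show 0 ≤ 1 / ε by positivity)).le
      rw [← hN] at this
      linarith
    calc Real.logb 2 N ≤ Real.logb 2 (2 * (1 / ε)) :=
          Real.logb_le_logb_of_le (by norm_num) hN' h1
      _ = 1 + Real.logb 2 (1 / ε) := by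
          rw [Real.logb_mul (by norm_num) (by positivity), Real.logb_self_eq_one (by norm_num)]
      _ ≤ 2 * M := by have := le_max_right 1 (Real.logb 2 (1 / ε)); linarith
  have hlM : 0 ≤ l * M := mul_nonneg hl0 (by linarith)
  by_cases hle : n * n ≤ q
  · rw [degreeParam, if_pos hle, trialParam, if_pos hle]
    split_ifs with h1
    · push_cast
      linarith
    · have hn2 : (2 : ℝ) ≤ n := by exact_mod_cast (show 2 ≤ n by omega)
      have h2l : Real.logb q 2 ≤ l := Real.logb_le_logb_of_le hq' (by norm_num) hn2
      have hNl : Real.logb q N ≤ 2 * (l * M) := by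
        calc Real.logb q N = Real.logb q 2 * Real.logb 2 N :=
              (Real.mul_logb (by norm_num) (by norm_num) (by norm_num)).symm
          _ ≤ l * (2 * M) := by
              refine mul_le_mul h2l hlogN (Real.logb_nonneg (by norm_num) ?_) hl0
              exact_mod_cast hN1
          _ = 2 * (l * M) := by ring
      have := natCast_clog_le hq hN1
      push_cast
      linarith
  · rw [degreeParam, if_neg hle, trialParam, if_neg hle]
    have hn2 : 2 ≤ n := by
      by_contra h
      have : n * n ≤ 1 * 1 := Nat.mul_le_mul (by omega) (by omega)
      omega
    have hn2' : (2 : ℝ) ≤ n := by exact_mod_cast hn2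
    have h2l : Real.logb q 2 ≤ l := Real.logb_le_logb_of_le hq' (by norm_num) hn2'
    -- a constant number of extra coordinates is paid for by `log_q n > 1 / 2`
    have hlhalf : 1 ≤ 2 * l := by
      have h : (q : ℝ) ≤ n * n := by exact_mod_cast (not_le.1 hle).le
      have := Real.logb_le_logb_of_le hq' (by linarith) h
      rw [Real.logb_self_eq_one hq', Real.logb_mul (by linarith) (by linarith), ← hl] at this
      linarith
    have hm : (Nat.clog q (8 * n) : ℝ) ≤ 6 * l := by
      have h := natCast_clog_le hq (show 1 ≤ 8 * n by omega)
      push_cast at h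
      rw [Real.logb_mul (by norm_num) (by linarith), ← hl, show (8 : ℝ) = 2 ^ 3 by norm_num,
        Real.logb_pow] at h
      push_cast at h
      linarith
    have hk : (Nat.clog 2 N : ℝ) ≤ 3 * M := by
      have := natCast_clog_le (b := 2) (by norm_num) hN1
      push_cast at this
      linarith
    push_cast
    calc 3 * (Nat.clog 2 N : ℝ) * (2 * Nat.clog q (8 * n)) ≤ 3 * (3 * M) * (2 * (6 * l)) := by
          gcongr
      _ = 108 * (l * M) := by ring
      _ ≤ _ := by linarith

/-- The total number of operations is within the required bound. -/
theorem cost_le {q n T : ℕ} (hq : 1 < q) (hn : 1 ≤ n) (hT : 1 ≤ T) {ε : ℝ}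
    (hε : 0 < ε) (hε1 : ε < 1) :
    ((prepareCost n T + trialParam q n ⌈1 / ε⌉₊ *
      (degreeParam q n + testCost n (degreeParam q n)) : ℕ) : ℝ) ≤
      8000 * ((T : ℝ) * n + n * Real.logb q n * max 1 (Real.logb 2 (1 / ε))) := by
  have hbudget := trialParam_mul_degreeParam_le hq hn hT hε hε1
  set d := degreeParam q n with hd
  set k := trialParam q n ⌈1 / ε⌉₊ with hk
  set B := Real.logb q n * max 1 (Real.logb 2 (1 / ε)) with hB
  have hd1 : 1 ≤ d := degreeParam_pos hq hn
  have hB0 : 0 ≤ B := mul_nonneg (Real.logb_nonneg (by exact_mod_cast hq) (by exact_mod_cast hn))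
    (by have := le_max_left 1 (Real.logb 2 (1 / ε)); linarith)
  have h1 : prepareCost n T ≤ 5 * (T * n) := by
    rw [prepareCost]; nlinarith
  have h2 : d + testCost n d ≤ 73 * (n * d) := by
    rw [testCost]; nlinarith [Nat.mul_le_mul hn hd1]
  have h3 : prepareCost n T + k * (d + testCost n d) ≤ 5 * (T * n) + 73 * (n * (k * d)) := by
    calc _ ≤ 5 * (T * n) + k * (73 * (n * d)) := by gcongr
      _ = _ := by ring
  have h3' : ((prepareCost n T + k * (d + testCost n d) : ℕ) : ℝ) ≤
      5 * (T * n) + 73 * (n * (k * d)) := by exact_mod_cast h3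
  have hn0 : (0 : ℝ) ≤ n := Nat.cast_nonneg n
  calc _ ≤ 5 * ((T : ℝ) * n) + 73 * (n * (k * d)) := h3'
    _ ≤ 5 * ((T : ℝ) * n) + 73 * (n * (2 * T + 108 * B)) := by gcongr
    _ = 151 * ((T : ℝ) * n) + 7884 * (n * B) := by ring
    _ ≤ 8000 * ((T : ℝ) * n) + 8000 * (n * B) := by
      have : (0 : ℝ) ≤ T * n := by positivity
      have : 0 ≤ n * B := mul_nonneg hn0 hB0
      linarith
    _ = _ := by rw [hB]; ring

/-- The behaviour of the verification program on every input. -/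
theorem wp_verifier {F G H P : K[X]} {ε : ℝ} (hP : P.Monic) (hn : 1 ≤ P.natDegree)
    (hF : F.degree < P.natDegree) (hG : G.degree < P.natDegree) (hH : H.degree < P.natDegree) :
    verifier.wp (input F G H P ε) fun t =>
      t.ops = prepareCost P.natDegree P.support.card +
        trialParam (Fintype.card K) P.natDegree ⌈1 / ε⌉₊ *
          (degreeParam (Fintype.card K) P.natDegree +
            testCost P.natDegree (degreeParam (Fintype.card K) P.natDegree)) ∧
      (H = (F * G).modByMonic P → t.int 2 0 = 1) := by
  rw [verifier, wp_seq]
  refine (wp_prepare hG).mono ?_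
  rintro s ⟨hs, s6, s2, sops⟩
  have hd := degreeParam_pos (Fintype.one_lt_card (α := K)) hn
  set d := degreeParam (Fintype.card K) P.natDegree
  refine wp_loop (fun i t => Ready F G H P d t ∧
    t.ops = s.ops + i * (d + testCost P.natDegree d) ∧
    (H = (F * G).modByMonic P → t.int 2 0 = 1)) ⟨hs, by simp, fun _ => s2⟩ (fun i _ t ht => ?_)
    (fun t ht => ?_)
  · have ht' : Ready F G H P d (t.putInt 22 0 i) := ht.1.of_eq
      (by simp [State.putInt, write_of_ne]) (by simp [State.putInt, write_of_ne]) (fun _ _ => rfl)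
    refine (wp_trial hP hn hd hF hG hH _ ht').mono ?_
    rintro u ⟨u1, u2, -, u4⟩
    refine ⟨u1, ?_, fun h => ?_⟩
    · rw [u2]
      change t.ops + _ = _
      rw [ht.2.1]; ring
    · rw [u4 h, ← ht.2.2 h]
      simp [State.putInt, write_of_ne]
  · obtain ⟨-, t2, t3⟩ := ht
    simp only [IntExpr.eval, s6] at t2
    exact ⟨by rw [t2, sops], t3⟩

/-- The trials err independently of each other. -/
theorem prob_verifier_le {F G H P : K[X]} {ε : ℝ} (hP : P.Monic) (hn : 1 ≤ P.natDegree)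
    (hF : F.degree < P.natDegree) (hG : G.degree < P.natDegree) (hH : H.degree < P.natDegree) :
    verifier.prob (input F G H P ε) {t | t.int 2 0 = 1} ≤
      ENNReal.ofReal (divisorRatio ((F * G).modByMonic P - H)
        (degreeParam (Fintype.card K) P.natDegree)) ^
          trialParam (Fintype.card K) P.natDegree ⌈1 / ε⌉₊ := by
  refine prob_seq_le ((wp_prepare hG).mono ?_)
  rintro s ⟨hs, s6, -, -⟩
  have hd := degreeParam_pos (Fintype.one_lt_card (α := K)) hn
  set d := degreeParam (Fintype.card K) P.natDegree
  have hput : ∀ i t, Ready F G H P d t → Ready F G H P d (t.putInt 22 0 i) := fun i t ht =>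
    ht.of_eq (by simp [State.putInt, write_of_ne]) (by simp [State.putInt, write_of_ne])
      (fun _ _ => rfl)
  rw [← s6]
  exact toOuterMeasure_iterate_le (Ready F G H P d) _ _ _ hs
    (fun i t ht u hu => (wp_trial hP hn hd hF hG hH _ (hput i t ht) u hu).1)
    (fun i t ht htE u hu => (wp_trial hP hn hd hF hG hH _ (hput i t ht) u hu).2.2.1
      (by simpa [State.putInt, write_of_ne] using htE))
    (fun i t ht => prob_trial_le hP hn hd hF hG hH _ (hput i t ht))

end

end FieldRAM

theorem mainTheorem5 :
    ∃ (A : FieldRAM.Prog) (C : ℝ), 0 < C ∧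
      ∀ (K : Type*) [Field K] [Fintype K] (n : ℕ) (F G H P : Polynomial K) (ε : ℝ),
        1 ≤ n → P.Monic → P.natDegree = n →
        F.degree < n → G.degree < n → H.degree < n →
        0 < ε → ε < 1 →
        (∀ t ∈ (A.run (FieldRAM.input F G H P ε)).support,
          (t.ops : ℝ) ≤ C * ((P.support.card : ℝ) * n +
            n * Real.logb (Fintype.card K) n * max 1 (Real.logb 2 (1 / ε)))) ∧
        (H = (F * G).modByMonic P → A.answer (FieldRAM.input F G H P ε) true = 1) ∧
        (H ≠ (F * G).modByMonic P →
          A.answer (FieldRAM.input F G H P ε) true ≤ ENNReal.ofReal ε) := by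
  refine ⟨FieldRAM.verifier, 8000, by norm_num, ?_⟩
  rintro K _ _ n F G H P ε hn hP rfl hF hG hH hε hε1
  have hwp := FieldRAM.wp_verifier (ε := ε) hP hn hF hG hH
  refine ⟨fun t ht => ?_, fun h => ?_, fun h => ?_⟩
  · rw [(hwp t ht).1]
    exact FieldRAM.cost_le Fintype.one_lt_card hn
      (Finset.card_pos.2 (Polynomial.support_nonempty.2 hP.ne_zero)) hε hε1
  · rw [FieldRAM.answer_true_eq, FieldRAM.Prog.prob, PMF.toOuterMeasure_apply_eq_one_iff]
    exact fun t ht => (hwp t ht).2 h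
  · rw [FieldRAM.answer_true_eq]
    refine (FieldRAM.prob_verifier_le hP hn hF hG hH).trans ?_
    rw [← ENNReal.ofReal_pow (by rw [FieldRAM.divisorRatio]; positivity)]
    refine ENNReal.ofReal_le_ofReal (FieldRAM.divisorRatio_pow_le (sub_ne_zero.2 (Ne.symm h)) ?_ hε)
    rw [Polynomial.natDegree_lt_iff_degree_lt (sub_ne_zero.2 (Ne.symm h))]
    refine (Polynomial.degree_sub_le _ _).trans_lt (max_lt ?_ hH)
    rw [← Polynomial.degree_eq_natDegree hP.ne_zero]
    exact Polynomial.degree_modByMonic_lt _ hP
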